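/- For $\tau\in\mathbb C$ with $\operatorname{Im}\tau>0$ write $q^x:=e^{2\pi i\tau x}$, and let $\eta$ be the Dedekind eta function. For $m\in\frac12\mathbb Z_{>0}$, $s\in\frac12\mathbb Z$, $k\in\mathbb Z$ and $z,z_1,z_2,t\in\mathbb C$ put $$\theta_{k,m}(\tau,z)=\sum_{j\in\mathbb Z}e^{2\pi i m(j+\frac{k}{2m})z}\,q^{m(j+\frac{k}{2m})^2},\qquad \vartheta_{ab}(\tau,z)=\sum_{n\in\mathbb Z}e^{\pi i(n+\frac a2)^2\tau+2\pi i(n+\frac a2)(z+\frac b2)}\quad(a,b\in\{0,1\}),$$ and $\Phi^{[m,s]}:=\Phi^{[m,s]}_1-\Phi^{[m,s]}_2$, where $$\Phi^{[m,s]}_1(\tau,z_1,z_2,t)=e^{-2\pi imt}\sum_{j\in\mathbb Z}\frac{e^{2\pi imj(z_1+z_2)+2\pi isz_1}q^{mj^2+sj}}{1-e^{2\pi iz_1}q^j},\qquad \Phi^{[m,s]}_2(\tau,z_1,z_2,t)=e^{-2\pi imt}\sum_{j\in\mathbb Z}\frac{e^{-2\pi imj(z_1+z_2)-2\pi isz_2}q^{mj^2+sj}}{1-e^{-2\pi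 iz_2}q^j}.$$ **Proposition.** Let $m\ge 1$ be an integer, $\operatorname{Im}\tau>0$, and let $z_1,z_3\in\mathbb C\setminus(\frac12\mathbb Z+\mathbb Z\tau)$ (so that no denominator below vanishes). Then $$\begin{aligned} &\theta_{0,m+1}\Big(\tau,\tfrac{-\frac12+m(z_1+z_3)}{m+1}\Big)\Big\{\Phi^{[m,0]}(\tau,z_1,-z_3,0)-\Phi^{[m,0]}\big(\tau,z_1+\tfrac12,-z_3-\tfrac12,0\big)\Big\}\\ &=2i\,\eta(\tau)^2\eta(2\tau)^2\Bigg\{-\frac{\theta_{0,m+1}\big(\tau,\frac{\frac12+z_1+z_3}{m+1}+z_1-z_3\big)}{\vartheta_{11}(\tau,z_1)\vartheta_{10}(\tau,z_1)}+\frac{\theta_{0,m+1}\big(\tau,\frac{\frac12+z_1+z_3}{m+1}-z_1+z_3\big)}{\vartheta_{11}(\tau,z_3)\vartheta_{10}(\tau,z_3)}\Bigg\}\\ &\quad+2\sum_{j=1}^{\infty}\sum_{r=1}^{j}\sum_{\substack{1\le k\le m-1\\ k\text{ odd}}}(-1)^jq^{(m+1)j^2-\frac{(2m(j-r)+k)^2}{4m}}\big\{e^{\pi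 i(2mr-k)(z_1+z_3)}+e^{-\pi i(2mr-k)(z_1+z_3)}\big\}\big[\theta_{k,m}-\theta_{-k,m}\big](\tau,z_1-z_3)\\ &\quad-2\sum_{j=1}^{\infty}\sum_{r=0}^{j-1}\sum_{\substack{1\le k\le m-1\\ k\text{ odd}}}(-1)^jq^{(m+1)j^2-\frac{(2m(j-r)-k)^2}{4m}}\big\{e^{\pi i(2mr+k)(z_1+z_3)}+e^{-\pi i(2mr+k)(z_1+z_3)}\big\}\big[\theta_{k,m}-\theta_{-k,m}\big](\tau,z_1-z_3), \end{aligned}$$ where both series over $j$ converge absolutely (the inner sums over $r$ and $k$ being finite). -/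

import Mathlib

noncomputable section

namespace MockTheta

/-- `q ^ x := exp (2 π i τ x)`, for an arbitrary (in particular rational) exponent `x`. -/
def qPow (τ x : ℂ) : ℂ := Complex.exp (2 * Real.pi * Complex.I * τ * x)

/-- `e ^ (2 π i x)`. -/
def e (x : ℂ) : ℂ := Complex.exp (2 * Real.pi * Complex.I * x)

/-- The series `Φ₁^{[m,s]}(τ, z₁, z₂, t)`. -/
def Phi1 (m s τ z₁ z₂ t : ℂ) : ℂ :=
  e (-(m * t)) * ∑' j : ℤ,
    e (m * j * (z₁ + z₂) + s * z₁) * qPow τ (m * j ^ 2 + s * j) / (1 - e z₁ * qPow τ j)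

/-- The series `Φ₂^{[m,s]}(τ, z₁, z₂, t)`. -/
def Phi2 (m s τ z₁ z₂ t : ℂ) : ℂ :=
  e (-(m * t)) * ∑' j : ℤ,
    e (-(m * j * (z₁ + z₂)) - s * z₂) * qPow τ (m * j ^ 2 + s * j) / (1 - e (-z₂) * qPow τ j)

/-- The mock theta function `Φ^{[m,s]} = Φ₁^{[m,s]} - Φ₂^{[m,s]}`. -/
def Phi (m s τ z₁ z₂ t : ℂ) : ℂ := Phi1 m s τ z₁ z₂ t - Phi2 m s τ z₁ z₂ t

/-- Jacobi's theta function `θ_{k,m}(τ, z)`. -/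
def theta (k m τ z : ℂ) : ℂ :=
  ∑' j : ℤ, e (m * (j + k / (2 * m)) * z) * qPow τ (m * (j + k / (2 * m)) ^ 2)

/-- Mumford's theta functions with characteristics
`ϑ_{ab}(τ, z) = ∑ₙ exp (π i (n + a/2)² τ + 2 π i (n + a/2) (z + b/2))`, `a, b ∈ {0, 1}`. -/
def thetaMumford (a b τ z : ℂ) : ℂ :=
  ∑' n : ℤ, Complex.exp (Real.pi * Complex.I * (n + a / 2) ^ 2 * τ
    + 2 * Real.pi * Complex.I * (n + a / 2) * (z + b / 2))

/-- The `j`-th term of the first triple sum: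
the sum over `1 ≤ r ≤ j` and odd `k` with `1 ≤ k ≤ m - 1`, where `e (x / 2) = exp (π i x)`. -/
def termA (m : ℕ) (τ z₁ z₃ : ℂ) (j : ℕ) : ℂ :=
  ∑ r ∈ Finset.Icc 1 j, ∑ k ∈ (Finset.Ico 1 m).filter (fun k => Odd k),
    (-1) ^ j * qPow τ ((m + 1) * (j : ℂ) ^ 2 - (2 * m * ((j : ℂ) - r) + k) ^ 2 / (4 * m))
      * (e ((2 * m * r - k) * (z₁ + z₃) / 2) + e (-((2 * m * r - k) * (z₁ + z₃) / 2)))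
      * (theta k m τ (z₁ - z₃) - theta (-k) m τ (z₁ - z₃))

/-- The `j`-th term of the second triple sum:
the sum over `0 ≤ r ≤ j - 1` and odd `k` with `1 ≤ k ≤ m - 1`. -/
def termB (m : ℕ) (τ z₁ z₃ : ℂ) (j : ℕ) : ℂ :=
  ∑ r ∈ Finset.range j, ∑ k ∈ (Finset.Ico 1 m).filter (fun k => Odd k),
    (-1) ^ j * qPow τ ((m + 1) * (j : ℂ) ^ 2 - (2 * m * ((j : ℂ) - r) - k) ^ 2 / (4 * m))
      * (e ((2 * m * r + k) * (z₁ + z₃) / 2) + e (-((2 * m * r + k) * (z₁ + z₃) / 2)))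
      * (theta k m τ (z₁ - z₃) - theta (-k) m τ (z₁ - z₃))

end MockTheta

end

/-! Write `q = e τ`. Since `1/(1-X) - 1/(1+X) = 2X/(1-X²)`, the bracket on the left is `2 (appell z₁
z₃ - appell z₃ z₁)`, with denominators `1 - e(2z) q^(2j)` (`Phi_sub_Phi`). The theta factor
multiplying it is an alternating theta series `altTheta`.

The heart is `altTheta_mul_appell_sub`. Put `y = e(2z) q^(2(n-p))`. In the product of `altTheta` and
`appell`, and in the product of another `altTheta` and `polarSeries`, the general terms differ by a
multiple of `(y^(mn) - y^(-p))/(1-y)`, a finite signed geometric sum over `i`. The resulting triple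
series `coreTerm` converges absolutely. Summing over `n` first kills one of its two indicators,
because a complete alternating theta sum vanishes; what remains factors, for each `i`, as
`partialTheta * thetaFactor`.

Two further facts finish the proof. First, `polarSeries` is the partial fraction expansion of the
eta-theta quotient (`eta_div_thetaMumford`), obtained with the Jacobi triple product as the limit of
finite `q`-binomial identities. Second, antisymmetrizing in `z₁, z₃` and pairing `i` with `-(i+1)`
leaves a sum over odd `c = 2i+1` of theta differences that depend on `c` only modulo `2m` and are
odd in `c`; sorting `c` by residue yields the two triple sums (`tsum_partialTheta_mul_sub`). -/

open Filter Topology Finset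

namespace MockTheta

/-! ### Gaussian binomials and finite partial fractions. -/

/-- The finite `q`-Pochhammer symbol `(Q; Q)ₙ`. -/
noncomputable def qPoch (Q : ℂ) (n : ℕ) : ℂ := ∏ k ∈ range n, (1 - Q ^ (k + 1))

/-- The Gaussian binomial coefficients, by their Pascal recursion. -/
noncomputable def gaussBinom (Q : ℂ) : ℕ → ℕ → ℂ
  | _, 0 => 1
  | 0, _ + 1 => 0
  | n + 1, k + 1 => Q ^ (k + 1) * gaussBinom Q n (k + 1) + gaussBinom Q n k

@[simp] lemma gaussBinom_zero_right (Q : ℂ) (n : ℕ) : gaussBinom Q n 0 = 1 := by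
  cases n <;> rfl

lemma gaussBinom_succ_succ (Q : ℂ) (n k : ℕ) :
    gaussBinom Q (n + 1) (k + 1) = Q ^ (k + 1) * gaussBinom Q n (k + 1) + gaussBinom Q n k := rfl

lemma gaussBinom_eq_zero (Q : ℂ) {n k : ℕ} (h : n < k) : gaussBinom Q n k = 0 := by
  induction n generalizing k with
  | zero => obtain ⟨k, rfl⟩ := Nat.exists_eq_add_of_lt h; simp [gaussBinom]
  | succ n ih =>
    obtain ⟨k, rfl⟩ : ∃ j, k = j + 1 := ⟨k - 1, by omega⟩
    rw [gaussBinom_succ_succ, ih (by omega), ih (by omega)]; simp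

@[simp] lemma gaussBinom_self (Q : ℂ) (n : ℕ) : gaussBinom Q n n = 1 := by
  induction n with
  | zero => simp
  | succ n ih => rw [gaussBinom_succ_succ, ih, gaussBinom_eq_zero Q (by omega)]; simp

lemma qPoch_succ (Q : ℂ) (n : ℕ) : qPoch Q (n + 1) = qPoch Q n * (1 - Q ^ (n + 1)) := by
  simp [qPoch, prod_range_succ]

@[simp] lemma qPoch_zero (Q : ℂ) : qPoch Q 0 = 1 := by simp [qPoch]

/-- Pascal induction on `a + b`, from `1 - Q^(a+b) = (1 - Q^a) + Q^a (1 - Q^b)`. Stated without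
division, it holds for every `Q`. -/
lemma gaussBinom_mul_qPoch (Q : ℂ) (a b : ℕ) :
    gaussBinom Q (a + b) a * qPoch Q a * qPoch Q b = qPoch Q (a + b) := by
  induction h : a + b generalizing a b with
  | zero => obtain ⟨rfl, rfl⟩ : a = 0 ∧ b = 0 := by omega
            simp
  | succ n ih =>
    rcases a with _ | a
    · simp at h; subst h; simp
    rcases b with _ | b
    · simp at h; subst h; simp
    have h1 := ih (a + 1) b (by omega)
    have h2 := ih a (b + 1) (by omega)
    rw [gaussBinom_succ_succ]
    simp only [qPoch_succ] at *
    have : n = a + 1 + b := by omega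
    subst this
    linear_combination Q ^ (a + 1) * (1 - Q ^ (b + 1)) * h1 + (1 - Q ^ (a + 1)) * h2

lemma one_sub_pow_ne_zero {Q : ℂ} (hQ : ‖Q‖ < 1) (n : ℕ) : 1 - Q ^ (n + 1) ≠ 0 := by
  rw [sub_ne_zero]
  intro h
  have := congrArg norm h
  rw [norm_one, norm_pow] at this
  exact absurd this.symm (pow_lt_one₀ (norm_nonneg _) hQ (by omega)).ne

lemma qPoch_ne_zero {Q : ℂ} (hQ : ‖Q‖ < 1) (n : ℕ) : qPoch Q n ≠ 0 :=
  prod_ne_zero_iff.mpr fun k _ => one_sub_pow_ne_zero hQ k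

/-- The second Pascal recursion. -/
lemma gaussBinom_succ_succ' {Q : ℂ} (hQ : ‖Q‖ < 1) (k d : ℕ) :
    gaussBinom Q (k + d + 1) (k + 1)
      = gaussBinom Q (k + d) (k + 1) + Q ^ d * gaussBinom Q (k + d) k := by
  rcases d with _ | d
  · simp [gaussBinom_eq_zero]
  have h1 := gaussBinom_mul_qPoch Q (k + 1) (d + 1)
  have h2 := gaussBinom_mul_qPoch Q (k + 1) d
  have h3 := gaussBinom_mul_qPoch Q k (d + 1)
  have e1 : k + 1 + (d + 1) = k + (d + 1) + 1 := by ring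
  have e2 : k + 1 + d = k + (d + 1) := by ring
  rw [e1] at h1
  rw [e2] at h2
  -- Only this cancellation needs `‖Q‖ < 1`.
  apply mul_right_cancel₀ (mul_ne_zero (qPoch_ne_zero hQ (k + 1)) (qPoch_ne_zero hQ (d + 1)))
  simp only [qPoch_succ] at *
  have e3 : k + (d + 1) + 1 = k + d + 2 := by ring
  have e4 : k + (d + 1) = k + d + 1 := by ring
  rw [e3, e4] at *
  linear_combination h1 - (1 - Q ^ (d + 1)) * h2 - Q ^ (d + 1) * (1 - Q ^ (k + 1)) * h3

/-- Rothe's `q`-binomial theorem, with `Q = h ^ 2`. -/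
lemma prod_one_sub_mul_pow (h x : ℂ) (n : ℕ) :
    ∏ k ∈ range n, (1 - x * (h ^ 2) ^ k)
      = ∑ j ∈ range (n + 1), (-1) ^ j * h ^ (j * (j - 1)) * gaussBinom (h ^ 2) n j * x ^ j := by
  induction n generalizing x with
  | zero => simp
  | succ n ih =>
    rw [prod_range_succ']
    have : ∀ k ∈ range n, (1 - x * (h ^ 2) ^ (k + 1)) = 1 - (x * h ^ 2) * (h ^ 2) ^ k := by
      intro k _; ring
    rw [prod_congr rfl this, ih, sum_range_succ' _ (n + 1)]
    have key : ∀ j ∈ range (n + 1), (-1 : ℂ) ^ (j + 1) * h ^ ((j + 1) * (j + 1 - 1))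
          * gaussBinom (h ^ 2) (n + 1) (j + 1) * x ^ (j + 1)
        = (-1 : ℂ) ^ (j + 1) * h ^ ((j + 1) * (j + 1 - 1))
            * gaussBinom (h ^ 2) n (j + 1) * (x * h ^ 2) ^ (j + 1)
          + (-1 : ℂ) ^ j * h ^ (j * (j - 1))
            * gaussBinom (h ^ 2) n j * (x * h ^ 2) ^ j * (-x) := by
      intro j _
      rw [gaussBinom_succ_succ]
      have : h ^ ((j + 1) * (j + 1 - 1)) = h ^ (j * (j - 1)) * (h ^ 2) ^ j := by
        rw [← pow_mul, ← pow_add]; congr 1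
        rcases j with _ | j
        · rfl
        · simp only [Nat.add_sub_cancel]; ring
      rw [this]; ring
    rw [sum_congr rfl key, sum_add_distrib, ← sum_mul]
    have h2 := sum_range_succ' (fun j => (-1 : ℂ) ^ j * h ^ (j * (j - 1))
            * gaussBinom (h ^ 2) n j * (x * h ^ 2) ^ j) (n + 1)
    rw [sum_range_succ, gaussBinom_eq_zero (h ^ 2) (Nat.lt_succ_self n)] at h2
    simp at h2 ⊢
    linear_combination h2

lemma sum_range_succ_of_split {t A B : ℕ → ℂ} (n : ℕ) (h0 : t 0 = A 0)
    (h : ∀ j ∈ range (n + 1), t (j + 1) = A (j + 1) + B j) (hA : A (n + 1) = 0) :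
    ∑ j ∈ range (n + 2), t j = ∑ j ∈ range (n + 1), A j + ∑ j ∈ range (n + 1), B j := by
  rw [sum_range_succ', sum_congr rfl h, sum_add_distrib, h0, add_right_comm,
    ← sum_range_succ' A (n + 1), sum_range_succ A, hA, add_zero]

/-- The partial fraction expansion of `y ^ r (Q; Q)ₙ / (y; Q)ₙ₊₁` with `Q = h ^ 2`. -/
lemma sum_gaussBinom_div {h : ℂ} (h0 : h ≠ 0) (hh : ‖h ^ 2‖ < 1) (d r : ℕ) {y : ℂ}
    (hy : ∀ j : ℕ, 1 - y * (h ^ 2) ^ j ≠ 0) :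
    ∑ j ∈ range (r + d + 1), (-1) ^ j * h ^ ((j : ℤ) * (j + 1) - 2 * j * r)
        * gaussBinom (h ^ 2) (r + d) j / (1 - y * (h ^ 2) ^ j)
      = y ^ r * qPoch (h ^ 2) (r + d) / ∏ k ∈ range (r + d + 1), (1 - y * (h ^ 2) ^ k) := by
  have shift : ∀ {y : ℂ}, (∀ j : ℕ, 1 - y * (h ^ 2) ^ j ≠ 0) → ∀ n,
      ∏ k ∈ range (n + 1), (1 - y * h ^ 2 * (h ^ 2) ^ k)
      = (∏ k ∈ range (n + 1), (1 - y * (h ^ 2) ^ k)) * (1 - y * (h ^ 2) ^ (n + 1)) / (1 - y) := by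
    intro y hy n
    have h1 : (1 : ℂ) - y ≠ 0 := by simpa using hy 0
    rw [eq_div_iff h1, ← prod_range_succ, prod_range_succ' _ (n + 1)]
    simp only [pow_zero, mul_one]
    congr 1
    exact prod_congr rfl fun k _ => by ring
  have hy' : ∀ {y : ℂ}, (∀ j : ℕ, 1 - y * (h ^ 2) ^ j ≠ 0) →
      ∀ j : ℕ, 1 - y * h ^ 2 * (h ^ 2) ^ j ≠ 0 := fun hy j => by
    have := hy (j + 1); rwa [pow_succ', ← mul_assoc] at this
  have hp : ∀ {y : ℂ}, (∀ j : ℕ, 1 - y * (h ^ 2) ^ j ≠ 0) →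
      ∀ n, ∏ k ∈ range n, (1 - y * (h ^ 2) ^ k) ≠ 0 :=
    fun hy n => prod_ne_zero_iff.mpr fun k _ => hy k
  induction r generalizing y with
  | zero =>
    induction d generalizing y with
    | zero => simp
    | succ d ih =>
      -- With `S_d(y)` the left side and `Q = h²`, the second Pascal recursion gives `S_{d+1}(y) =
      -- S_d(y) - Q^(d+1) S_d(yQ)`.
      rw [show 0 + (d + 1) + 1 = d + 2 by ring, sum_range_succ_of_split
        (A := fun j => (-1) ^ j * h ^ ((j : ℤ) * (j + 1) - 2 * j * (0 : ℕ))
          * gaussBinom (h ^ 2) (0 + d) j / (1 - y * (h ^ 2) ^ j))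
        (B := fun j => -(h ^ 2) ^ (d + 1) * ((-1) ^ j * h ^ ((j : ℤ) * (j + 1) - 2 * j * (0 : ℕ))
          * gaussBinom (h ^ 2) (0 + d) j / (1 - y * h ^ 2 * (h ^ 2) ^ j)))]
      · have e1 := ih hy
        have e2 := ih (hy' hy)
        rw [zero_add] at e1 e2
        simp only [zero_add]
        rw [← mul_sum, e1, e2, shift hy, prod_range_succ _ (d + 1), qPoch_succ]
        have a1 := hy (d + 1)
        have a2 := hp hy (d + 1)
        have a3 : (1 : ℂ) - y ≠ 0 := by simpa using hy 0
        field_simp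
        ring
      · simp
      · intro j hj
        obtain ⟨e, rfl⟩ : ∃ e, d = j + e := Nat.exists_eq_add_of_le (by simp at hj; omega)
        have a1 := hy (j + 1)
        have a2 : 1 - y * h ^ 2 * (h ^ 2) ^ j ≠ 0 := hy' hy j
        have e1 : h ^ (((j + 1 : ℕ) : ℤ) * ((j + 1 : ℕ) + 1) - 2 * (j + 1 : ℕ) * (0 : ℕ))
          = h ^ ((j : ℤ) * (j + 1) - 2 * j * (0 : ℕ)) * (h ^ 2) ^ (j + 1) := by
          rw [← pow_mul, ← zpow_natCast h (2 * (j + 1)), ← zpow_add₀ h0]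
          congr 1; push_cast; ring
        rw [e1, show 0 + (j + e + 1) = j + e + 1 by ring, gaussBinom_succ_succ' hh, zero_add,
          show y * h ^ 2 * (h ^ 2) ^ j = y * (h ^ 2) ^ (j + 1) by ring]
        ring
      · simp [gaussBinom_eq_zero]
  | succ r ih =>
    -- Here the first Pascal recursion gives `S_{r+1}(y) = S_r(y) - Q^(-r) S_r(yQ)`.
    rw [show r + 1 + d + 1 = (r + d) + 2 by ring, sum_range_succ_of_split
      (A := fun j => (-1) ^ j * h ^ ((j : ℤ) * (j + 1) - 2 * j * r)
        * gaussBinom (h ^ 2) (r + d) j / (1 - y * (h ^ 2) ^ j))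
      (B := fun j => -((h ^ 2) ^ r)⁻¹ * ((-1) ^ j * h ^ ((j : ℤ) * (j + 1) - 2 * j * r)
        * gaussBinom (h ^ 2) (r + d) j / (1 - y * h ^ 2 * (h ^ 2) ^ j)))]
    · rw [← mul_sum, ih hy, ih (hy' hy), shift hy, show r + 1 + d = r + d + 1 by ring,
        prod_range_succ _ (r + d + 1), qPoch_succ]
      have a1 := hy (r + d + 1)
      have a2 := hp hy (r + d + 1)
      have a3 : (1 : ℂ) - y ≠ 0 := by simpa using hy 0
      rw [mul_pow]
      field_simp
      ring
    · simp
    · intro j hj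
      have e1 : h ^ (((j + 1 : ℕ) : ℤ) * ((j + 1 : ℕ) + 1) - 2 * (j + 1 : ℕ) * (r + 1 : ℕ))
        = h ^ ((j : ℤ) * (j + 1) - 2 * j * r) * ((h ^ 2) ^ r)⁻¹ := by
        rw [← pow_mul, ← zpow_natCast h (2 * r), ← zpow_neg, ← zpow_add₀ h0]
        congr 1; push_cast; ring
      have e2 : h ^ (((j + 1 : ℕ) : ℤ) * ((j + 1 : ℕ) + 1) - 2 * (j + 1 : ℕ) * r)
        = h ^ (((j + 1 : ℕ) : ℤ) * ((j + 1 : ℕ) + 1) - 2 * (j + 1 : ℕ) * (r + 1 : ℕ))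
          * (h ^ 2) ^ (j + 1) := by
        rw [← pow_mul, ← zpow_natCast h (2 * (j + 1)), ← zpow_add₀ h0]
        congr 1; push_cast; ring
      rw [e2, e1, show r + 1 + d = r + d + 1 by ring, gaussBinom_succ_succ,
        show y * h ^ 2 * (h ^ 2) ^ j = y * (h ^ 2) ^ (j + 1) by ring]
      ring
    · simp [gaussBinom_eq_zero]

/-! ### Gaussian convergence estimates. -/

lemma summable_exp_neg_sq {a : ℝ} (ha : 0 < a) (b : ℝ) :
    Summable fun n : ℤ => Real.exp (-a * n ^ 2 + b * n) := by
  have hi : 0 < (((a / Real.pi : ℝ) : ℂ) * Complex.I).im := by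
    simp; positivity
  have := ((summable_jacobiTheta₂_term_iff (((-b / (2 * Real.pi) : ℝ) : ℂ) * Complex.I) _).mpr
    hi).norm
  refine this.congr fun n => ?_
  rw [norm_jacobiTheta₂_term]
  congr 1
  rw [Complex.im_ofReal_mul, Complex.im_ofReal_mul, Complex.I_im]
  field_simp
  ring

lemma summable_zpow_sq_mul_zpow {ρ R : ℝ} (h0 : 0 < ρ) (h1 : ρ < 1) (hR : 0 < R) :
    Summable fun n : ℤ => ρ ^ (n ^ 2) * R ^ n := by
  refine (summable_exp_neg_sq (a := -Real.log ρ) (by simpa using Real.log_neg h0 h1)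
    (Real.log R)).congr fun n => ?_
  rw [Real.exp_add]
  congr 1
  · rw [← Real.rpow_intCast, Real.rpow_def_of_pos h0]; congr 1; push_cast; ring
  · rw [← Real.rpow_intCast, Real.rpow_def_of_pos hR]

/-- The denominators `1 - y q ^ n` are bounded away from zero. -/
lemma exists_norm_inv_one_sub_mul_zpow_le {q y : ℂ} (hq0 : q ≠ 0) (hq : ‖q‖ < 1) (hy : y ≠ 0) :
    ∃ C, 0 < C ∧ ∀ n : ℤ, ‖(1 - y * q ^ n)⁻¹‖ ≤ C := by
  have hy' : 0 < ‖y‖ := norm_pos_iff.mpr hy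
  have hq' : 0 < ‖q‖ := norm_pos_iff.mpr hq0
  have lim := tendsto_pow_atTop_nhds_zero_of_lt_one (norm_nonneg q) hq
  obtain ⟨M, hM⟩ := (lim.eventually (ge_mem_nhds
    (show (0 : ℝ) < min (1 / (2 * ‖y‖)) (‖y‖ / 2) by positivity))).exists_forall_of_atTop
  -- Finitely many indices are bounded by a maximum, vanishing denominators being harmless since
  -- `0⁻¹ = 0`. Beyond them `‖y qⁿ‖` is at most `1/2` or at least `2`, so the inverse has norm at
  -- most `2`.
  obtain ⟨C, hC⟩ := ((Set.finite_Icc (-(M : ℤ)) M).image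
    fun n : ℤ => ‖(1 - y * q ^ n)⁻¹‖).bddAbove
  refine ⟨max C 2, by positivity, fun n => ?_⟩
  by_cases hn : n ∈ Set.Icc (-(M : ℤ)) M
  · exact (hC ⟨n, hn, rfl⟩).trans (le_max_left _ _)
  refine le_trans ?_ (le_max_right _ _)
  rw [norm_inv]
  refine inv_le_of_inv_le₀ (by norm_num) ?_
  rcases le_total 0 n with h | h
  · obtain ⟨k, rfl⟩ := Int.eq_ofNat_of_zero_le h
    have h2 := (hM k (by simp at hn; omega)).trans (min_le_left _ _)
    have h3 : ‖y * q ^ (k : ℤ)‖ ≤ 1 / 2 := by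
      rw [norm_mul, zpow_natCast, norm_pow]
      calc ‖y‖ * ‖q‖ ^ k ≤ ‖y‖ * (1 / (2 * ‖y‖)) := by gcongr
        _ = 1 / 2 := by field_simp
    have := norm_sub_norm_le (1 : ℂ) (y * q ^ (k : ℤ))
    rw [norm_one] at this
    linarith
  · obtain ⟨k, hk⟩ := Int.eq_ofNat_of_zero_le (show 0 ≤ -n by omega)
    obtain rfl : n = -(k : ℤ) := by omega
    have h2 := (hM k (by simp at hn; omega)).trans (min_le_right _ _)
    have h3 : 2 ≤ ‖y * q ^ (-(k : ℤ))‖ := by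
      rw [norm_mul, zpow_neg, zpow_natCast, norm_inv, norm_pow, ← div_eq_mul_inv,
        le_div_iff₀ (by positivity)]
      linarith
    have := norm_sub_norm_le (y * q ^ (-(k : ℤ))) 1
    rw [norm_one, norm_sub_rev] at this
    linarith

/-! ### Finite Jacobi triple product and finite partial fractions over `ℤ`. -/

lemma sum_Icc_neg_eq_sum_range {M : Type*} [AddCommMonoid M] (F : ℤ → M) (N : ℕ) :
    ∑ n ∈ Icc (-(N : ℤ)) N, F n = ∑ j ∈ range (N + N + 1), F ((j : ℤ) - N) := by
  symm
  refine sum_bij (fun j _ => (j : ℤ) - N) ?_ ?_ ?_ ?_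
  · intro j hj; simp at *; omega
  · intro a _ b _ h; simpa using h
  · intro n hn
    simp at hn
    exact ⟨(n + N).toNat, by simp; omega, by omega⟩
  · intros; rfl

/-- The centred Gaussian binomial coefficients. -/
noncomputable def centredBinom (Q : ℂ) (N : ℕ) (n : ℤ) : ℂ :=
  if n ∈ Icc (-(N : ℤ)) N then gaussBinom Q (N + N) (n + N).toNat else 0

/-- Writing the finite sum as a series over all of `ℤ` makes `N → ∞` a matter of dominated
convergence. -/
lemma tsum_mul_centredBinom (Q : ℂ) (F : ℤ → ℂ) (N : ℕ) :
    ∑' n : ℤ, F n * centredBinom Q N n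
      = ∑ j ∈ range (N + N + 1), F ((j : ℤ) - N) * gaussBinom Q (N + N) j := by
  rw [tsum_eq_sum (s := Icc (-(N : ℤ)) N), sum_Icc_neg_eq_sum_range]
  · refine sum_congr rfl fun j hj => ?_
    rw [centredBinom, if_pos (by simp at *; omega)]
    congr 2; omega
  · intro n hn
    rw [centredBinom, if_neg hn, mul_zero]

/-- Factor by factor, `1 - y Q^(-l) = -y Q^(-l) (1 - Q^l / y)` for `1 ≤ l ≤ N`, with `Q = h²`. -/
lemma prod_one_sub_mul_zpow_neg {h y : ℂ} (h0 : h ≠ 0) (hy : y ≠ 0) (N : ℕ) :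
    ∏ k ∈ range N, (1 - y * (h ^ 2) ^ (-(N : ℤ)) * (h ^ 2) ^ k)
      = (-y) ^ N * h ^ (-(N * (N + 1) : ℤ)) * ∏ k ∈ range N, (1 - (h ^ 2) ^ (k + 1) / y) := by
  have h2 : h ^ 2 ≠ 0 := pow_ne_zero _ h0
  induction N with
  | zero => simp
  | succ N ih =>
    rw [prod_range_succ']
    have : ∀ k ∈ range N, 1 - y * (h ^ 2) ^ (-((N + 1 : ℕ) : ℤ)) * (h ^ 2) ^ (k + 1)
        = 1 - y * (h ^ 2) ^ (-(N : ℤ)) * (h ^ 2) ^ k := by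
      intro k _
      rw [mul_assoc, mul_assoc, ← zpow_natCast (h ^ 2), ← zpow_natCast (h ^ 2), ← zpow_add₀ h2,
        ← zpow_add₀ h2]
      congr 3; push_cast; ring
    rw [prod_congr rfl this, ih, prod_range_succ]
    have e1 : h ^ (-(((N + 1 : ℕ) : ℤ) * ((N + 1 : ℕ) + 1)))
        = h ^ (-(N * (N + 1) : ℤ)) * ((h ^ 2) ^ (N + 1))⁻¹ := by
      rw [← pow_mul, ← zpow_natCast h (2 * (N + 1)), ← zpow_neg, ← zpow_add₀ h0]
      congr 1; push_cast; ring
    rw [e1, zpow_neg (h ^ 2), zpow_natCast (h ^ 2)]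
    have h3 : (h ^ 2) ^ (N + 1) ≠ 0 := pow_ne_zero _ h2
    field_simp
    ring

/-- The finite form of the Jacobi triple product. -/
lemma tsum_centredBinom_mul_zpow {h y : ℂ} (h0 : h ≠ 0) (hy : y ≠ 0) (N : ℕ) :
    ∑' n : ℤ, (-1) ^ n * h ^ (n * (n - 1)) * y ^ n * centredBinom (h ^ 2) N n
      = ∏ k ∈ range N, ((1 - y * (h ^ 2) ^ k) * (1 - (h ^ 2) ^ (k + 1) / y)) := by
  have h2 : h ^ 2 ≠ 0 := pow_ne_zero _ h0
  rw [tsum_mul_centredBinom]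
  -- Rothe's theorem with `2N` factors starting at `y Q^(-N)`: the lower half is reflected into
  -- powers of `1/y`, the upper half is already in the desired form.
  have key := prod_one_sub_mul_pow h (y * (h ^ 2) ^ (-(N : ℤ))) (N + N)
  rw [prod_range_add, prod_one_sub_mul_zpow_neg h0 hy] at key
  have : ∀ k ∈ range N, 1 - y * (h ^ 2) ^ (-(N : ℤ)) * (h ^ 2) ^ (N + k)
        = 1 - y * (h ^ 2) ^ k := by
    intro k _
    rw [pow_add, zpow_neg, zpow_natCast]
    field_simp
  rw [prod_congr rfl this] at key
  have c0 : (-y) ^ N * h ^ (-(N * (N + 1) : ℤ)) ≠ 0 :=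
    mul_ne_zero (pow_ne_zero _ (neg_ne_zero.mpr hy)) (zpow_ne_zero _ h0)
  apply mul_left_cancel₀ c0
  rw [prod_mul_distrib, mul_comm (∏ k ∈ range N, _), ← mul_assoc, key, mul_sum]
  refine sum_congr rfl fun j hj => ?_
  have e1 : h ^ (j * (j - 1)) = h ^ ((j : ℤ) * (j - 1)) := by
    rw [← zpow_natCast]; congr 1
    rcases j with _ | j <;> simp
  have e2 : (-1 : ℂ) ^ ((j : ℤ) - N) = (-1) ^ j * (-1) ^ N := by
    rw [zpow_sub₀ (by norm_num), zpow_natCast, zpow_natCast, div_eq_mul_inv, ← inv_pow]; norm_num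
  have e3 : y ^ N * y ^ ((j : ℤ) - N) = y ^ j := by
    rw [← zpow_natCast, ← zpow_natCast, ← zpow_add₀ hy]; congr 1; ring
  have e4 : ((h ^ 2) ^ (-(N : ℤ))) ^ j = h ^ (-2 * (N : ℤ) * j) := by
    rw [← zpow_natCast, ← zpow_natCast, ← zpow_mul, ← zpow_mul]; congr 1; push_cast; ring
  have e5 : h ^ (-(N * (N + 1) : ℤ)) * h ^ (((j : ℤ) - N) * ((j : ℤ) - N - 1))
      = h ^ ((j : ℤ) * (j - 1)) * h ^ (-2 * (N : ℤ) * j) := by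
    rw [← zpow_add₀ h0, ← zpow_add₀ h0]; congr 1; ring
  rw [mul_pow, e1, e2, e4, neg_pow y]
  have s : (-1 : ℂ) ^ N * (-1) ^ N = 1 := by rw [← mul_pow]; norm_num
  linear_combination (-1 : ℂ) ^ j * gaussBinom (h ^ 2) (N + N) j
    * (y ^ N * y ^ ((j : ℤ) - N) * (h ^ (-(N * (N + 1) : ℤ))
      * h ^ (((j : ℤ) - N) * ((j : ℤ) - N - 1))) * s
      + (h ^ (-(N * (N + 1) : ℤ)) * h ^ (((j : ℤ) - N) * ((j : ℤ) - N - 1))) * e3 + y ^ j * e5)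

/-- The finite form of the partial fraction expansion. -/
lemma tsum_centredBinom_div {h y : ℂ} (h0 : h ≠ 0) (hh : ‖h ^ 2‖ < 1) (hy : y ≠ 0)
    (hy' : ∀ n : ℤ, 1 - y * (h ^ 2) ^ n ≠ 0) (N : ℕ) :
    ∑' n : ℤ, (-1) ^ n * h ^ (n * (n + 1)) / (1 - y * (h ^ 2) ^ n) * centredBinom (h ^ 2) N n
      = qPoch (h ^ 2) (N + N) / ((∏ k ∈ range N, ((1 - y * (h ^ 2) ^ k)
          * (1 - (h ^ 2) ^ (k + 1) / y))) * (1 - y * (h ^ 2) ^ N)) := by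
  have h2 : h ^ 2 ≠ 0 := pow_ne_zero _ h0
  have hz : ∀ j : ℕ, y * (h ^ 2) ^ (-(N : ℤ)) * (h ^ 2) ^ j = y * (h ^ 2) ^ ((j : ℤ) - N) := by
    intro j
    rw [mul_assoc, ← zpow_natCast (h ^ 2), ← zpow_add₀ h2]; congr 2; ring
  rw [tsum_mul_centredBinom]
  -- The choice `r = N` turns the exponent `j(j+1) - 2jN` into `n(n+1)` with `n = j - N`, up to a
  -- constant.
  have key := sum_gaussBinom_div h0 hh N N (y := y * (h ^ 2) ^ (-(N : ℤ)))
    (fun j => by rw [hz]; exact hy' _)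
  rw [add_assoc, prod_range_add, prod_one_sub_mul_zpow_neg h0 hy] at key
  have : ∀ k ∈ range (N + 1), 1 - y * (h ^ 2) ^ (-(N : ℤ)) * (h ^ 2) ^ (N + k)
        = 1 - y * (h ^ 2) ^ k := by
    intro k _
    rw [pow_add, zpow_neg, zpow_natCast]
    field_simp
  rw [prod_congr rfl this, prod_range_succ] at key
  have c0 : (-1) ^ N * h ^ (-(N : ℤ) * N + N) ≠ 0 :=
    mul_ne_zero (pow_ne_zero _ (by norm_num)) (zpow_ne_zero _ h0)
  have e6 : (y * (h ^ 2) ^ (-(N : ℤ))) ^ N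
      = (-1) ^ N * h ^ (-(N : ℤ) * N + N) * ((-y) ^ N * h ^ (-(N * (N + 1) : ℤ))) := by
    have s : (-1 : ℂ) ^ N * (-1) ^ N = 1 := by rw [← mul_pow]; norm_num
    have e4 : ((h ^ 2) ^ (-(N : ℤ))) ^ N = h ^ (-(N : ℤ) * N + N) * h ^ (-(N * (N + 1) : ℤ)) := by
      rw [← zpow_natCast, ← zpow_natCast, ← zpow_mul, ← zpow_mul, ← zpow_add₀ h0]
      congr 1; push_cast; ring
    rw [mul_pow, e4, neg_pow y]
    linear_combination -y ^ N * h ^ (-(N : ℤ) * N + N) * h ^ (-(N * (N + 1) : ℤ)) * s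
  have c1 : (-y) ^ N * h ^ (-(N * (N + 1) : ℤ)) ≠ 0 :=
    mul_ne_zero (pow_ne_zero _ (neg_ne_zero.mpr hy)) (zpow_ne_zero _ h0)
  apply mul_left_cancel₀ c0
  rw [prod_mul_distrib]
  rw [e6] at key
  trans ∑ x ∈ range (N + (N + 1)), (-1) ^ x * h ^ ((x : ℤ) * (x + 1) - 2 * x * N)
    * gaussBinom (h ^ 2) (N + N) x / (1 - y * (h ^ 2) ^ (-(N : ℤ)) * (h ^ 2) ^ x)
  · rw [mul_sum, ← add_assoc]
    refine sum_congr rfl fun j _ => ?_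
    have e2 : (-1 : ℂ) ^ ((j : ℤ) - N) = (-1) ^ j * (-1) ^ N := by
      rw [zpow_sub₀ (by norm_num), zpow_natCast, zpow_natCast, div_eq_mul_inv, ← inv_pow]; norm_num
    have s : (-1 : ℂ) ^ N * (-1) ^ N = 1 := by rw [← mul_pow]; norm_num
    have e5 : h ^ ((j : ℤ) * (j + 1) - 2 * j * N)
        = h ^ (-(N : ℤ) * N + N) * h ^ (((j : ℤ) - N) * ((j : ℤ) - N + 1)) := by
      rw [← zpow_add₀ h0]; congr 1; ring
    rw [hz, e2, e5]
    linear_combination (-1 : ℂ) ^ j * h ^ (-(N : ℤ) * N + N)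
      * h ^ (((j : ℤ) - N) * ((j : ℤ) - N + 1)) * gaussBinom (h ^ 2) (N + N) j
      / (1 - y * (h ^ 2) ^ ((j : ℤ) - N)) * s
  · rw [key, mul_assoc _ (∏ k ∈ range N, (1 - (h ^ 2) ^ (k + 1) / y)), mul_assoc (_ * _) _ (qPoch _ _),
      mul_div_assoc, mul_div_mul_left _ _ c1]
    ring

/-! ### Passage to infinite products. -/

/-- The infinite product `(Q; Q)_∞`. -/
noncomputable def qPochInf (Q : ℂ) : ℂ := ∏' k : ℕ, (1 - Q ^ (k + 1))

/-- The infinite product `(y; Q)_∞ (Q / y; Q)_∞`. -/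
noncomputable def thetaProd (Q y : ℂ) : ℂ := ∏' k : ℕ, ((1 - y * Q ^ k) * (1 - Q ^ (k + 1) / y))

lemma summable_norm_mul_pow {Q : ℂ} (hQ : ‖Q‖ < 1) (y : ℂ) : Summable fun k : ℕ => ‖-(y * Q ^ k)‖ := by
  simp only [norm_neg, norm_mul, norm_pow]
  exact (summable_geometric_of_lt_one (norm_nonneg _) hQ).mul_left _

lemma multipliable_one_sub_mul_pow {Q : ℂ} (hQ : ‖Q‖ < 1) (y : ℂ) :
    Multipliable fun k : ℕ => 1 - y * Q ^ k := by
  simp only [sub_eq_add_neg]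
  exact multipliable_one_add_of_summable (summable_norm_mul_pow hQ y)

lemma tprod_one_sub_mul_pow_ne_zero {Q : ℂ} (hQ : ‖Q‖ < 1) {y : ℂ}
    (h : ∀ k : ℕ, 1 - y * Q ^ k ≠ 0) : ∏' k : ℕ, (1 - y * Q ^ k) ≠ 0 := by
  simp only [sub_eq_add_neg] at *
  exact tprod_one_add_ne_zero_of_summable h (summable_norm_mul_pow hQ y)

lemma one_sub_pow_succ_div (Q y : ℂ) (k : ℕ) : 1 - Q ^ (k + 1) / y = 1 - Q / y * Q ^ k := by ring

lemma multipliable_thetaProd {Q : ℂ} (hQ : ‖Q‖ < 1) (y : ℂ) :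
    Multipliable fun k : ℕ => (1 - y * Q ^ k) * (1 - Q ^ (k + 1) / y) := by
  simp only [one_sub_pow_succ_div]
  exact (multipliable_one_sub_mul_pow hQ y).mul (multipliable_one_sub_mul_pow hQ (Q / y))

lemma thetaProd_ne_zero {Q y : ℂ} (hQ0 : Q ≠ 0) (hQ : ‖Q‖ < 1) (hy0 : y ≠ 0)
    (hy : ∀ n : ℤ, 1 - y * Q ^ n ≠ 0) : thetaProd Q y ≠ 0 := by
  unfold thetaProd
  simp only [one_sub_pow_succ_div]
  rw [(multipliable_one_sub_mul_pow hQ y).tprod_mul (multipliable_one_sub_mul_pow hQ (Q / y))]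
  refine mul_ne_zero (tprod_one_sub_mul_pow_ne_zero hQ fun k => by simpa using hy k)
    (tprod_one_sub_mul_pow_ne_zero hQ fun k h => hy (-(k + 1 : ℕ)) ?_)
  rw [zpow_neg, zpow_natCast]
  have : Q ^ (k + 1) ≠ 0 := pow_ne_zero _ hQ0
  field_simp at h ⊢
  linear_combination -h

lemma tendsto_qPoch {Q : ℂ} (hQ : ‖Q‖ < 1) : Tendsto (qPoch Q) atTop (𝓝 (qPochInf Q)) :=
  (ModularForm.multipliable_one_sub_pow hQ).hasProd.tendsto_prod_nat

lemma qPochInf_ne_zero {Q : ℂ} (hQ : ‖Q‖ < 1) : qPochInf Q ≠ 0 := by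
  have := tprod_one_sub_mul_pow_ne_zero hQ (y := Q) fun k => by
    rw [← pow_succ']; exact one_sub_pow_ne_zero hQ k
  simpa only [qPochInf, pow_succ'] using this

lemma exists_norm_le_of_tendsto {u : ℕ → ℂ} {a : ℂ} (h : Tendsto u atTop (𝓝 a)) :
    ∃ C, 0 < C ∧ ∀ n, ‖u n‖ ≤ C := by
  obtain ⟨C, hC⟩ := h.norm.bddAbove_range
  exact ⟨max C 1, by positivity, fun n => (hC ⟨n, rfl⟩).trans (le_max_left _ _)⟩

lemma centredBinom_eq {Q : ℂ} (hQ : ‖Q‖ < 1) {N : ℕ} {n : ℤ} (hn : n ∈ Icc (-(N : ℤ)) N) :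
    centredBinom Q N n
      = qPoch Q (N + N) * (qPoch Q (N + n).toNat)⁻¹ * (qPoch Q (N - n).toNat)⁻¹ := by
  rw [centredBinom, if_pos hn]
  simp at hn
  have := gaussBinom_mul_qPoch Q (N + n).toNat (N - n).toNat
  rw [show (N + n).toNat + (N - n).toNat = N + N by omega] at this
  have h1 := qPoch_ne_zero hQ (N + n).toNat
  have h2 := qPoch_ne_zero hQ (N - n).toNat
  rw [← this, add_comm n]
  field_simp

lemma tendsto_centredBinom {Q : ℂ} (hQ : ‖Q‖ < 1) (n : ℤ) :
    Tendsto (fun N => centredBinom Q N n) atTop (𝓝 (qPochInf Q)⁻¹) := by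
  have t1 : Tendsto (fun N : ℕ => qPoch Q (N + N)) atTop (𝓝 (qPochInf Q)) :=
    (tendsto_qPoch hQ).comp (tendsto_atTop_mono (fun N => Nat.le_add_left N N) tendsto_id)
  have t2 : ∀ n : ℤ, Tendsto (fun N : ℕ => (qPoch Q (N + n).toNat)⁻¹) atTop
      (𝓝 (qPochInf Q)⁻¹) := fun n =>
    ((tendsto_qPoch hQ).comp (tendsto_atTop.mpr fun b => by
      filter_upwards [eventually_ge_atTop (b + n.natAbs)] with N hN; omega)).inv₀
      (qPochInf_ne_zero hQ)
  have t := (t1.mul (t2 n)).mul (t2 (-n))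
  rw [mul_inv_cancel₀ (qPochInf_ne_zero hQ), one_mul] at t
  refine t.congr' ?_
  filter_upwards [eventually_ge_atTop n.natAbs] with N hN
  rw [centredBinom_eq hQ (by simp; omega)]
  rfl

/-- The finite products converge to a nonzero limit, so they and their inverses are bounded; this is
the domination for the limit `N → ∞`. -/
lemma exists_norm_centredBinom_le {Q : ℂ} (hQ : ‖Q‖ < 1) :
    ∃ C, 0 < C ∧ ∀ N n, ‖centredBinom Q N n‖ ≤ C := by
  obtain ⟨C, hC0, hC⟩ := exists_norm_le_of_tendsto (tendsto_qPoch hQ)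
  obtain ⟨C', hC0', hC'⟩ := exists_norm_le_of_tendsto
    ((tendsto_qPoch hQ).inv₀ (qPochInf_ne_zero hQ))
  refine ⟨C * C' * C', by positivity, fun N n => ?_⟩
  by_cases hn : n ∈ Icc (-(N : ℤ)) N
  · rw [centredBinom_eq hQ hn, norm_mul, norm_mul]
    gcongr
    exacts [hC _, hC' _, hC' _]
  · rw [centredBinom, if_neg hn, norm_zero]; positivity

lemma tendsto_tsum_mul_centredBinom {Q : ℂ} (hQ : ‖Q‖ < 1) {F : ℤ → ℂ}
    (hF : Summable fun n => ‖F n‖) :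
    Tendsto (fun N => ∑' n, F n * centredBinom Q N n) atTop
      (𝓝 ((∑' n, F n) * (qPochInf Q)⁻¹)) := by
  obtain ⟨C, hC0, hC⟩ := exists_norm_centredBinom_le hQ
  rw [← tsum_mul_right]
  refine tendsto_tsum_of_dominated_convergence (hF.mul_right C)
    (fun n => (tendsto_centredBinom hQ n).const_mul _) (.of_forall fun N n => ?_)
  rw [norm_mul]
  gcongr
  exact hC N n

lemma summable_norm_sign_mul_zpow {h y : ℂ} (h0 : h ≠ 0) (hh : ‖h‖ < 1) (hy : y ≠ 0) :
    Summable fun n : ℤ => ‖(-1) ^ n * h ^ (n * (n - 1)) * y ^ n‖ := by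
  have h0' : 0 < ‖h‖ := norm_pos_iff.mpr h0
  refine (summable_zpow_sq_mul_zpow h0' hh (R := ‖y‖ / ‖h‖)
    (div_pos (norm_pos_iff.mpr hy) h0')).congr fun n => ?_
  rw [norm_mul, norm_mul, norm_zpow, norm_zpow, norm_zpow, norm_neg, norm_one, one_zpow, one_mul,
    div_zpow, mul_sub, mul_one, zpow_sub₀ h0'.ne', ← sq]
  ring

/-- The Jacobi triple product. -/
lemma tsum_sign_mul_zpow {h y : ℂ} (h0 : h ≠ 0) (hh : ‖h‖ < 1) (hy : y ≠ 0) :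
    ∑' n : ℤ, (-1) ^ n * h ^ (n * (n - 1)) * y ^ n
      = qPochInf (h ^ 2) * thetaProd (h ^ 2) y := by
  have hQ : ‖h ^ 2‖ < 1 := by rw [norm_pow]; exact pow_lt_one₀ (norm_nonneg _) hh (by norm_num)
  have t := tendsto_tsum_mul_centredBinom hQ (summable_norm_sign_mul_zpow h0 hh hy)
  simp only [tsum_centredBinom_mul_zpow h0 hy] at t
  have := tendsto_nhds_unique t (multipliable_thetaProd hQ y).hasProd.tendsto_prod_nat
  rw [thetaProd, ← this]
  field_simp [qPochInf_ne_zero hQ]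

/-- The partial fraction expansion of the reciprocal of a theta function. -/
lemma tsum_sign_mul_zpow_div {h y : ℂ} (h0 : h ≠ 0) (hh : ‖h‖ < 1) (hy : y ≠ 0)
    (hy' : ∀ n : ℤ, 1 - y * (h ^ 2) ^ n ≠ 0) :
    ∑' n : ℤ, (-1) ^ n * h ^ (n * (n + 1)) / (1 - y * (h ^ 2) ^ n)
      = qPochInf (h ^ 2) ^ 2 / thetaProd (h ^ 2) y := by
  have hQ : ‖h ^ 2‖ < 1 := by rw [norm_pow]; exact pow_lt_one₀ (norm_nonneg _) hh (by norm_num)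
  obtain ⟨C, -, hC⟩ := exists_norm_inv_one_sub_mul_zpow_le (pow_ne_zero 2 h0) hQ hy
  have hs : Summable fun n : ℤ => ‖(-1) ^ n * h ^ (n * (n + 1)) / (1 - y * (h ^ 2) ^ n)‖ := by
    refine .of_nonneg_of_le (fun _ => norm_nonneg _) (fun n => ?_)
      ((summable_norm_sign_mul_zpow h0 hh (pow_ne_zero 2 h0)).mul_right C)
    -- Domination by the triple product series at `y = h²`, the denominators being bounded away from
    -- zero.
    have e1 : h ^ (n * (n + 1)) = h ^ (n * (n - 1)) * (h ^ 2) ^ n := by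
      rw [← zpow_natCast h 2, ← zpow_mul, ← zpow_add₀ h0]; congr 1; push_cast; ring
    rw [e1, div_eq_mul_inv, norm_mul, ← mul_assoc]
    gcongr
    exact hC n
  have t := tendsto_tsum_mul_centredBinom hQ hs
  simp only [tsum_centredBinom_div h0 hQ hy hy'] at t
  have t1 : Tendsto (fun N : ℕ => qPoch (h ^ 2) (N + N)) atTop (𝓝 (qPochInf (h ^ 2))) :=
    (tendsto_qPoch hQ).comp (tendsto_atTop_mono (fun N => Nat.le_add_left N N) tendsto_id)
  have t2 : Tendsto (fun N : ℕ => 1 - y * (h ^ 2) ^ N) atTop (𝓝 1) := by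
    simpa using ((tendsto_pow_atTop_nhds_zero_of_norm_lt_one hQ).const_mul y).const_sub 1
  have hne := thetaProd_ne_zero (pow_ne_zero 2 h0) hQ hy hy'
  have := tendsto_nhds_unique t (t1.div ((multipliable_thetaProd hQ y).hasProd.tendsto_prod_nat.mul
    t2) (by rw [mul_one]; exact hne))
  have h3 := qPochInf_ne_zero hQ
  change _ = qPochInf (h ^ 2) / (thetaProd (h ^ 2) y * 1) at this
  rw [mul_one, mul_inv_eq_iff_eq_mul₀ h3] at this
  rw [this]
  ring

/-- Factorwise `(1-x)(1+x) = 1-x²`. This merges `ϑ₁₁ ϑ₁₀` into one theta product of base `q²`. -/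
lemma thetaProd_mul_thetaProd_neg {q : ℂ} (hq : ‖q‖ < 1) (y : ℂ) :
    thetaProd q y * thetaProd q (-y) = thetaProd (q ^ 2) (y ^ 2) := by
  rw [thetaProd, thetaProd, ← (multipliable_thetaProd hq y).tprod_mul (multipliable_thetaProd hq (-y))]
  refine tprod_congr fun k => ?_
  rw [div_neg]
  ring

/-! ### The eta-theta quotient as a partial fraction series. -/

lemma e_add (x y : ℂ) : e (x + y) = e x * e y := by
  rw [e, e, e, ← Complex.exp_add]; congr 1; ring

@[simp] lemma e_zero : e 0 = 1 := by simp [e]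

lemma e_ne_zero (x : ℂ) : e x ≠ 0 := Complex.exp_ne_zero _

lemma e_neg (x : ℂ) : e (-x) = (e x)⁻¹ := by
  rw [e, e, ← Complex.exp_neg]; congr 1; ring

lemma e_int_mul (n : ℤ) (x : ℂ) : e (n * x) = e x ^ n := by
  rw [e, e, ← Complex.exp_int_mul]; congr 1; ring

lemma e_int (n : ℤ) : e n = 1 := by
  rw [e, mul_comm]; exact Complex.exp_int_mul_two_pi_mul_I n

lemma e_half : e (1 / 2) = -1 := by
  rw [e, ← Complex.exp_pi_mul_I]; congr 1; ring

lemma e_quarter : e (1 / 4) = Complex.I := by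
  rw [e, show 2 * (Real.pi : ℂ) * Complex.I * (1 / 4) = (Real.pi : ℂ) / 2 * Complex.I by ring]
  exact Complex.exp_pi_div_two_mul_I

lemma e_int_div_two (n : ℤ) : e (n / 2) = (-1) ^ n := by
  rw [← e_half, ← e_int_mul]; congr 1; ring

lemma norm_e (x : ℂ) : ‖e x‖ = Real.exp (-2 * Real.pi * x.im) := by
  rw [e, Complex.norm_exp]; congr 1
  simp [Complex.mul_re]

lemma qPow_eq_e (τ x : ℂ) : qPow τ x = e (τ * x) := by
  rw [qPow, e]; congr 1; ring

lemma e_eq_one_iff {x : ℂ} : e x = 1 ↔ ∃ n : ℤ, x = n := by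
  rw [e, Complex.exp_eq_one_iff]
  refine exists_congr fun n => ?_
  rw [mul_comm (n : ℂ)]
  exact mul_right_inj' Complex.two_pi_I_ne_zero

lemma norm_e_lt_one {τ : ℂ} (hτ : 0 < τ.im) : ‖e τ‖ < 1 := by
  rw [norm_e, Real.exp_lt_one_iff]
  have := Real.pi_pos
  nlinarith

lemma one_sub_e_ne_zero {τ z : ℂ} (hz : ∀ a b : ℤ, z ≠ (a : ℂ) / 2 + b * τ) (j : ℤ) :
    1 - e (2 * z + 2 * j * τ) ≠ 0 := by
  rw [sub_ne_zero]
  intro h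
  obtain ⟨n, hn⟩ := e_eq_one_iff.mp h.symm
  refine hz n (-j) ?_
  push_cast
  linear_combination hn / 2

/-- The partial fraction series of `1 / (ϑ₁₁ ϑ₁₀)`. -/
noncomputable def polarSeries (τ z : ℂ) : ℂ :=
  ∑' n : ℤ, (-1) ^ n * e (τ * (n ^ 2 + n) + z) / (1 - e (2 * z + 2 * n * τ))

lemma thetaProd_mul_left {Q : ℂ} (hQ : Q ≠ 0) (y : ℂ) : thetaProd Q (Q * y) = thetaProd Q y⁻¹ := by
  refine tprod_congr fun k => ?_
  have : Q ^ (k + 1) / (Q * y) = y⁻¹ * Q ^ k := by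
    rw [pow_succ', mul_div_mul_left _ _ hQ]; ring
  rw [this, mul_comm, div_inv_eq_mul]
  ring

/-- The partial fraction expansion at `y = e(-2z)`, read with `n ↦ -n`. The inverse matches the form
in which `thetaProd_mul_left` delivers the product `ϑ₁₁ ϑ₁₀`. -/
lemma polarSeries_eq {τ z : ℂ} (hτ : 0 < τ.im) (hz : ∀ a b : ℤ, z ≠ (a : ℂ) / 2 + b * τ) :
    thetaProd (e τ ^ 2) ((e z ^ 2)⁻¹) ≠ 0 ∧
    polarSeries τ z = -(e z)⁻¹ * (qPochInf (e τ ^ 2) ^ 2 / thetaProd (e τ ^ 2) ((e z ^ 2)⁻¹)) := by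
  have hq0 := e_ne_zero τ
  have hw := e_ne_zero z
  have hq := norm_e_lt_one hτ
  have hQ : ‖e τ ^ 2‖ < 1 := by rw [norm_pow]; exact pow_lt_one₀ (norm_nonneg _) hq (by norm_num)
  have hden : ∀ n : ℤ, 1 - e z ^ 2 * (e τ ^ 2) ^ n ≠ 0 := fun n => by
    have := one_sub_e_ne_zero hz n
    rwa [e_add, show 2 * z = (2 : ℤ) * z by push_cast; ring,
      show 2 * n * τ = (2 * n : ℤ) * τ by push_cast; ring, e_int_mul, e_int_mul, zpow_mul] at this
  have hz' : ∀ n : ℤ, (e τ ^ 2) ^ n ≠ 0 := fun n => zpow_ne_zero _ (pow_ne_zero 2 hq0)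
  have hden' : ∀ n : ℤ, 1 - (e z ^ 2)⁻¹ * (e τ ^ 2) ^ n ≠ 0 := fun n h => by
    have h1 := hden (-n)
    have h2 := hz' n
    rw [zpow_neg] at h1
    apply h1
    field_simp at h ⊢
    linear_combination -h
  refine ⟨thetaProd_ne_zero (pow_ne_zero 2 hq0) hQ (inv_ne_zero (pow_ne_zero 2 hw)) hden', ?_⟩
  rw [← tsum_sign_mul_zpow_div hq0 hq (inv_ne_zero (pow_ne_zero 2 hw)) hden', polarSeries,
    ← (Equiv.neg ℤ).tsum_eq (fun n : ℤ => (-1 : ℂ) ^ n * e τ ^ (n * (n + 1))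
      / (1 - (e z ^ 2)⁻¹ * (e τ ^ 2) ^ n)), ← tsum_mul_left]
  refine tsum_congr fun n => ?_
  simp only [Equiv.neg_apply]
  have h1 := hden n
  have h2 := hden' (-n)
  have h3 := hz' n
  have e1 : e (τ * (n ^ 2 + n) + z) = e τ ^ (-n * (-n + 1)) * (e τ ^ 2) ^ n * e z := by
    rw [e_add, show τ * ((n : ℂ) ^ 2 + n) = ((n ^ 2 + n : ℤ) : ℂ) * τ by push_cast; ring,
      e_int_mul, ← zpow_natCast (e τ) 2, ← zpow_mul, ← zpow_add₀ hq0]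
    congr 2; push_cast; ring
  have e2 : e (2 * z + 2 * n * τ) = e z ^ 2 * (e τ ^ 2) ^ n := by
    rw [e_add, show 2 * z = (2 : ℤ) * z by push_cast; ring,
      show 2 * n * τ = (2 * n : ℤ) * τ by push_cast; ring, e_int_mul, e_int_mul, zpow_mul]
    rfl
  have e3 : (-1 : ℂ) ^ (-n) = (-1) ^ n := by rw [zpow_neg, ← inv_zpow]; norm_num
  rw [e1, e2, e3]
  rw [zpow_neg] at h2 ⊢
  have h4 : e z ^ 2 * (e τ ^ 2) ^ n - 1 ≠ 0 := by rw [← neg_sub, neg_ne_zero]; exact h1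
  have h5 : 1 - (e z ^ 2)⁻¹ * ((e τ ^ 2) ^ n)⁻¹
      = (e z ^ 2 * (e τ ^ 2) ^ n - 1) / (e z ^ 2 * (e τ ^ 2) ^ n) := by field_simp
  rw [h5, ← neg_sub (e z ^ 2 * (e τ ^ 2) ^ n)]
  field_simp

lemma eta_eq (τ : ℂ) : ModularForm.eta τ = e (τ / 24) * qPochInf (e τ) := by
  rw [ModularForm.eta, qPochInf]
  congr 1
  · rw [Function.Periodic.qParam, e]; congr 1; push_cast; ring
  · refine tprod_congr fun n => ?_
    rw [ModularForm.eta_q_eq_pow]; rfl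

lemma e_half_mul_sq (τ : ℂ) : e (τ / 2) ^ 2 = e τ := by
  rw [← zpow_natCast, ← e_int_mul]; congr 1; push_cast; ring

lemma thetaMumford_eq {τ : ℂ} (hτ : 0 < τ.im) (b z : ℂ) :
    thetaMumford 1 b τ z
      = e (τ / 8 + z / 2 + b / 4) * (qPochInf (e τ) * thetaProd (e τ) (e τ * e (z + b / 2 + 1 / 2))) := by
  have hq : ‖e (τ / 2)‖ < 1 := norm_e_lt_one (by
    rw [show τ / 2 = ((1 / 2 : ℝ) : ℂ) * τ by push_cast; ring, Complex.im_ofReal_mul]; linarith)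
  have := tsum_sign_mul_zpow (e_ne_zero (τ / 2)) hq
    (mul_ne_zero (e_ne_zero τ) (e_ne_zero (z + b / 2 + 1 / 2)))
  rw [e_half_mul_sq] at this
  rw [← this, ← tsum_mul_left, thetaMumford]
  refine tsum_congr fun n => ?_
  rw [← e_add, ← e_int_mul, ← e_int_mul, ← e_int_div_two, ← e_add, ← e_add, ← e_add]
  trans e ((n + 1 / 2) ^ 2 * τ / 2 + (n + 1 / 2) * (z + b / 2))
  · rw [e]; congr 1; ring
  -- The sign `(-1)^n` and the factor `e(n/2)` contained in `y^n` multiply to `e n = 1`.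
  · have h := e_add ((n + 1 / 2) ^ 2 * τ / 2 + (n + 1 / 2) * (z + b / 2)) n
    rw [e_int, mul_one] at h
    rw [← h]
    congr 1; push_cast; ring

/-- The triple product writes `ϑ₁₁ ϑ₁₀` as `(q;q)_∞²` times a theta product of base `q²`. The first
factor cancels against `η(τ)²`, and `η(2τ)²` supplies the numerator `(q²;q²)_∞²`. -/
lemma eta_div_thetaMumford {τ z : ℂ} (hτ : 0 < τ.im) (hz : ∀ a b : ℤ, z ≠ (a : ℂ) / 2 + b * τ) :
    Complex.I * ModularForm.eta τ ^ 2 * ModularForm.eta (2 * τ) ^ 2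
      / (thetaMumford 1 1 τ z * thetaMumford 1 0 τ z) = -polarSeries τ z := by
  obtain ⟨hne, hp⟩ := polarSeries_eq hτ hz
  have hq := norm_e_lt_one hτ
  have e2 : e (2 * τ) = e τ ^ 2 := by
    rw [show 2 * τ = ((2 : ℕ) : ℤ) * τ by push_cast; ring, e_int_mul, zpow_natCast]
  have t1 : e (z + 1 / 2 + 1 / 2) = e z := by
    rw [add_assoc, show (1 / 2 + 1 / 2 : ℂ) = (1 : ℤ) by norm_num, e_add, e_int, mul_one]
  have t2 : e (z + 0 / 2 + 1 / 2) = -e z := by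
    rw [zero_div, add_zero, e_add, e_half]; ring
  have t3 := thetaProd_mul_thetaProd_neg hq (e τ * e z)
  rw [mul_pow, thetaProd_mul_left (pow_ne_zero 2 (e_ne_zero τ))] at t3
  rw [hp, thetaMumford_eq hτ, thetaMumford_eq hτ, t1, t2, eta_eq, eta_eq, e2, mul_neg]
  -- The powers of `q` balance because `2/8 = 2/24 + 4/24`; the factor `i` is `e(1/4)`.
  have c : e (τ / 8 + z / 2 + 1 / 4) * e (τ / 8 + z / 2 + 0 / 4)
      = Complex.I * e (τ / 24) ^ 2 * e (2 * τ / 24) ^ 2 * e z := by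
    rw [← e_quarter, sq, sq, ← e_add, ← e_add, ← e_add, ← e_add, ← e_add, ← e_add]
    congr 1; ring
  have h1 := qPochInf_ne_zero hq
  have : e (τ / 8 + z / 2 + 1 / 4) * (qPochInf (e τ) * thetaProd (e τ) (e τ * e z))
      * (e (τ / 8 + z / 2 + 0 / 4) * (qPochInf (e τ) * thetaProd (e τ) (-(e τ * e z))))
      = Complex.I * e (τ / 24) ^ 2 * e (2 * τ / 24) ^ 2 * e z * qPochInf (e τ) ^ 2
        * thetaProd (e τ ^ 2) ((e z ^ 2)⁻¹) := by
    rw [← c, ← t3]; ring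
  rw [this]
  have h2 := e_ne_zero z
  have h3 := e_ne_zero (τ / 24)
  have h4 := e_ne_zero (2 * τ / 24)
  have h5 := Complex.I_ne_zero
  generalize thetaProd (e τ ^ 2) ((e z ^ 2)⁻¹) = T at hne ⊢
  generalize e (2 * τ / 24) = a at h4 ⊢
  field_simp

/-! ### The triple series and its absolute convergence. -/

/-- The indicator difference has finite support, so no condition `‖y‖ < 1` is needed and both orders
of `A, B` are covered. All denominators `1 - y` can thus be expanded uniformly. -/
lemma hasSum_zpow_mul_indicator_sub {y : ℂ} (h0 : y ≠ 0) (h1 : 1 - y ≠ 0) (A B : ℤ) :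
    HasSum (fun i : ℤ => y ^ i * ((if A ≤ i then 1 else 0) - (if B ≤ i then 1 else 0)))
      ((y ^ A - y ^ B) / (1 - y)) := by
  have main : ∀ (A : ℤ) (d : ℕ), HasSum (fun i : ℤ => y ^ i * ((if A ≤ i then 1 else 0)
      - (if A + d ≤ i then 1 else 0))) ((y ^ A - y ^ (A + d)) / (1 - y)) := by
    intro A d
    induction d with
    | zero => simp
    | succ d ih =>
      convert ih.add (hasSum_ite_eq (A + d) (y ^ (A + d))) using 1
      · funext i
        by_cases hi : i = A + d
        · subst hi; simp
        · have : (A + (d + 1 : ℕ) ≤ i) ↔ A + d ≤ i := by push_cast; omega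
          simp only [this]
          simp [hi]
      · push_cast
        rw [← add_assoc, zpow_add_one₀ h0]
        field_simp
        ring
  rcases le_total A B with h | h
  · obtain ⟨d, rfl⟩ := Int.le.dest h
    exact main A d
  · obtain ⟨d, rfl⟩ := Int.le.dest h
    have := (main B d).neg
    simp only [← mul_neg, neg_sub, ← neg_div] at this
    exact this

lemma summable_norm_e_sq {α : ℂ} (hα : 0 < α.im) (β γ : ℂ) :
    Summable fun n : ℤ => ‖e (α * n ^ 2 + β * n + γ)‖ := by
  refine ((summable_exp_neg_sq (a := 2 * Real.pi * α.im) (by positivity)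
    (-2 * Real.pi * β.im)).mul_right (Real.exp (-2 * Real.pi * γ.im))).congr fun n => ?_
  have h1 : (α * n ^ 2).im = α.im * n ^ 2 := by
    have := Complex.im_mul_ofReal α ((n : ℝ) ^ 2)
    push_cast at this; exact this
  have h2 : (β * n).im = β.im * n := by
    have := Complex.im_mul_ofReal β (n : ℝ)
    push_cast at this; exact this
  rw [norm_e, ← Real.exp_add, Complex.add_im, Complex.add_im, h1, h2]
  congr 1; ring

/-- The general term of the triple series behind the product formula. -/
noncomputable def coreTerm (m : ℕ) (τ z u : ℂ) (p n i : ℤ) : ℂ :=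
  (-1) ^ n * e (τ * (n ^ 2 + n * (2 * i + 1) + m * p ^ 2 - p * (2 * i + 1))
      + (2 * i + 1 - m * p) * z + m * p * u)
    * ((if m * n ≤ i then 1 else 0) - (if -p ≤ i then 1 else 0))

/-- The hypothesis says that `c` lies between `2mn` and `-2p`. The right side is affine in `c`, so
it is at least its smaller endpoint value, which is at least `(n²+p²)/2`. Half of that bound
controls `c²`, since `c² ≤ (2mn)² + (2p)²`. -/
lemma core_exponent_bound {m n p c : ℝ} (hm : 1 ≤ m) (h : (c - 2 * m * n) * (c + 2 * p) ≤ 0) :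
    (n ^ 2 + p ^ 2) / 4 + c ^ 2 / (16 * m ^ 2) ≤ n ^ 2 + n * c + m * p ^ 2 - p * c := by
  have hA : (n ^ 2 + p ^ 2) / 2 ≤ n ^ 2 + n * (2 * m * n) + m * p ^ 2 - p * (2 * m * n) := by
    nlinarith [sq_nonneg (2 * n - p), sq_nonneg n, sq_nonneg p, sq_nonneg (n - p),
      mul_nonneg (sub_nonneg.mpr hm) (add_nonneg (sq_nonneg n) (sq_nonneg (n - p)))]
  have hB : (n ^ 2 + p ^ 2) / 2 ≤ n ^ 2 + n * (-2 * p) + m * p ^ 2 - p * (-2 * p) := by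
    nlinarith [sq_nonneg (n - 2 * p), sq_nonneg n, sq_nonneg p, sq_nonneg (n - p),
      mul_nonneg (sub_nonneg.mpr hm) (sq_nonneg p)]
  have hc : c ^ 2 / (16 * m ^ 2) ≤ (n ^ 2 + p ^ 2) / 4 := by
    rw [div_le_iff₀ (by positivity)]
    have h1 : c ^ 2 ≤ (2 * m * n) ^ 2 + (2 * p) ^ 2 := by
      nlinarith [sq_nonneg (c - 2 * m * n + 2 * p)]
    have h2 : 1 ≤ m ^ 2 := by nlinarith
    nlinarith [mul_nonneg (sub_nonneg.mpr h2) (sq_nonneg p)]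
  have hE : (n ^ 2 + p ^ 2) / 2 ≤ n ^ 2 + n * c + m * p ^ 2 - p * c := by
    rcases le_total c (2 * m * n) with h1 | h1 <;> rcases le_total (-2 * p) c with h2 | h2
    · rcases le_total n p with h3 | h3
      · nlinarith [mul_nonneg (sub_nonneg.mpr h1) (sub_nonneg.mpr h3)]
      · nlinarith [mul_nonneg (sub_nonneg.mpr h2) (sub_nonneg.mpr h3)]
    · have : c = 2 * m * n ∨ c = -2 * p := by
        by_contra! hne
        have a1 := lt_of_le_of_ne h1 hne.1
        have a2 := lt_of_le_of_ne h2 hne.2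
        nlinarith [mul_pos (sub_pos.mpr a1) (sub_pos.mpr a2)]
      rcases this with h | h <;> rw [h] <;> assumption
    · have : c = 2 * m * n ∨ c = -2 * p := by
        by_contra! hne
        have a1 := lt_of_le_of_ne h1 hne.1.symm
        have a2 := lt_of_le_of_ne h2 hne.2.symm
        nlinarith [mul_pos (sub_pos.mpr a1) (sub_pos.mpr a2)]
      rcases this with h | h <;> rw [h] <;> assumption
    · rcases le_total n p with h3 | h3
      · nlinarith [mul_nonneg (sub_nonneg.mpr h2) (sub_nonneg.mpr h3)]
      · nlinarith [mul_nonneg (sub_nonneg.mpr h1) (sub_nonneg.mpr h3)]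
  linarith

lemma im_real_mul_add (τ a b c : ℂ) (r s t : ℝ) :
    (τ * r + s * a + t * b + c).im = τ.im * r + s * a.im + t * b.im + c.im := by
  simp [Complex.mul_im]

lemma norm_coreTerm_le {m : ℕ} (hm : 1 ≤ m) {τ : ℂ} (hτ : 0 < τ.im) (z u : ℂ) (p n i : ℤ) :
    ‖coreTerm m τ z u p n i‖ ≤ ‖e (τ / 4 * n ^ 2 + 0 * n + 0)‖
      * ‖e (τ / 4 * p ^ 2 + m * (u - z) * p + 0)‖
      * ‖e (τ / (4 * m ^ 2) * i ^ 2 + (τ / (4 * m ^ 2) + 2 * z) * i + (τ / (16 * m ^ 2) + z))‖ := by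
  rw [← norm_mul, ← norm_mul, ← e_add, ← e_add]
  -- If the indicators agree the term is zero; otherwise `c = 2i+1` lies between `2mn` and `-2p`,
  -- and the exponent bound applies.
  by_cases hi : ((m : ℤ) * n ≤ i ↔ -p ≤ i)
  · rw [coreTerm]; simp [hi]
  have hm' : (1 : ℝ) ≤ m := by exact_mod_cast hm
  have hm0 : (m : ℂ) ≠ 0 := by exact_mod_cast (by omega : m ≠ 0)
  have hone : ‖((if (m : ℤ) * n ≤ i then 1 else 0) - (if -p ≤ i then 1 else 0) : ℂ)‖ ≤ 1 := by
    split_ifs <;> simp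
  have hc : (((2 * i + 1 : ℤ) : ℝ) - 2 * m * n) * ((2 * i + 1 : ℤ) + 2 * p) ≤ 0 := by
    have : (2 * i + 1 - 2 * (m * n)) * (2 * i + 1 + 2 * p) ≤ 0 := by
      have h := not_iff.mp hi
      by_cases h1 : (m : ℤ) * n ≤ i
      · have : ¬ -p ≤ i := fun h2 => (h.mpr h2) h1
        exact mul_nonpos_of_nonneg_of_nonpos (by omega) (by omega)
      · have := h.mp h1
        exact mul_nonpos_of_nonpos_of_nonneg (by omega) (by omega)
    have h2 : (((2 * i + 1 - 2 * (m * n)) * (2 * i + 1 + 2 * p) : ℤ) : ℝ) ≤ 0 := by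
      exact_mod_cast this
    push_cast at h2 ⊢
    linarith
  have hb := core_exponent_bound hm' hc
  rw [coreTerm, norm_mul, norm_mul, norm_zpow, norm_neg, norm_one, one_zpow, one_mul]
  refine (mul_le_of_le_one_right (norm_nonneg _) hone).trans ?_
  rw [norm_e, norm_e, Real.exp_le_exp]
  have e1 : τ * (n ^ 2 + n * (2 * i + 1) + m * p ^ 2 - p * (2 * i + 1))
      + (2 * i + 1 - m * p) * z + m * p * u
      = τ * (((n : ℝ) ^ 2 + n * (2 * i + 1 : ℤ) + m * p ^ 2 - p * (2 * i + 1 : ℤ) : ℝ) : ℂ)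
        + ((2 * i + 1 : ℝ) : ℂ) * z + ((m * p : ℝ) : ℂ) * (u - z) + 0 := by
    push_cast; ring
  have e2 : τ / 4 * n ^ 2 + 0 * n + 0 + (τ / 4 * p ^ 2 + m * (u - z) * p + 0)
      + (τ / (4 * m ^ 2) * i ^ 2 + (τ / (4 * m ^ 2) + 2 * z) * i + (τ / (16 * m ^ 2) + z))
      = τ * ((((n : ℝ) ^ 2 + p ^ 2) / 4 + ((2 * i + 1 : ℤ) : ℝ) ^ 2 / (16 * m ^ 2) : ℝ) : ℂ)
        + ((2 * i + 1 : ℝ) : ℂ) * z + ((m * p : ℝ) : ℂ) * (u - z) + 0 := by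
    push_cast; field_simp; ring
  rw [e1, e2, im_real_mul_add, im_real_mul_add]
  have := mul_le_mul_of_nonneg_left hb hτ.le
  have := mul_le_mul_of_nonneg_left this Real.pi_pos.le
  linarith

lemma im_div_natCast_pos {τ : ℂ} (hτ : 0 < τ.im) {k : ℕ} (hk : 0 < k) : 0 < (τ / k).im := by
  have : (τ / k).im = τ.im / k := Complex.div_natCast_im τ k
  rw [this]; positivity

lemma summable_coreTerm {m : ℕ} (hm : 1 ≤ m) {τ : ℂ} (hτ : 0 < τ.im) (z u : ℂ) :
    Summable fun x : (ℤ × ℤ) × ℤ => coreTerm m τ z u x.1.1 x.1.2 x.2 := by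
  have h4 : 0 < (τ / 4).im := by exact_mod_cast im_div_natCast_pos hτ (k := 4) (by norm_num)
  have hm4 : 0 < (τ / (4 * m ^ 2)).im := by
    exact_mod_cast im_div_natCast_pos hτ (k := 4 * m ^ 2) (by positivity)
  refine .of_norm_bounded (((summable_norm_e_sq h4 (m * (u - z)) 0).mul_of_nonneg
    (summable_norm_e_sq h4 0 0) (fun _ => norm_nonneg _) (fun _ => norm_nonneg _)).mul_of_nonneg
    (summable_norm_e_sq hm4 (τ / (4 * m ^ 2) + 2 * z) (τ / (16 * m ^ 2) + z))
    (fun _ => by positivity) (fun _ => norm_nonneg _)) fun x => ?_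
  refine (norm_coreTerm_le hm hτ z u _ _ _).trans (le_of_eq ?_)
  ring

/-! ### The product formula: two orders of summation. -/

/-- The partial alternating theta series `∑_{mn ≤ i} (-1)ⁿ q ^ (n² + n (2 i + 1))`. -/
noncomputable def partialTheta (m : ℕ) (τ : ℂ) (i : ℤ) : ℂ :=
  ∑' n : ℤ, (-1) ^ n * e (τ * (n ^ 2 + n * (2 * i + 1))) * (if m * n ≤ i then 1 else 0)

/-- The theta series multiplying `partialTheta`. -/
noncomputable def thetaFactor (m : ℕ) (τ z u : ℂ) (i : ℤ) : ℂ :=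
  ∑' p : ℤ, e (τ * (m * p ^ 2 - p * (2 * i + 1)) + (2 * i + 1 - m * p) * z + m * p * u)

/-- The Appell series obtained by symmetrizing `Phi1` under `z ↦ z + 1 / 2`. -/
noncomputable def appell (m : ℕ) (τ z u : ℂ) : ℂ :=
  ∑' j : ℤ, e (τ * (m * j ^ 2 + j) + m * j * (z - u) + z) / (1 - e (2 * z + 2 * j * τ))

/-- The alternating theta series `∑ (-1)ⁿ q ^ ((m + 1) n²) e(n x)`. -/
noncomputable def altTheta (m : ℕ) (τ x : ℂ) : ℂ :=
  ∑' n : ℤ, (-1) ^ n * e (τ * ((m + 1) * n ^ 2) + n * x)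

lemma norm_neg_one_zpow_mul (n : ℤ) (x : ℂ) : ‖(-1) ^ n * x‖ = ‖x‖ := by
  rw [norm_mul, norm_zpow, norm_neg, norm_one, one_zpow, one_mul]

lemma summable_sign_mul_e {τ : ℂ} (hτ : 0 < τ.im) (i : ℤ) :
    Summable fun n : ℤ => (-1) ^ n * e (τ * (n ^ 2 + n * (2 * i + 1))) := by
  refine .of_norm ((summable_norm_e_sq hτ (τ * (2 * i + 1)) 0).congr fun n => ?_)
  rw [norm_neg_one_zpow_mul]
  congr 2; ring

/-- The involution `n ↦ -(2i+1) - n` preserves `n(n+2i+1)` and reverses the sign. -/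
lemma tsum_sign_mul_e_eq_zero (τ : ℂ) (i : ℤ) :
    ∑' n : ℤ, (-1) ^ n * e (τ * (n ^ 2 + n * (2 * i + 1))) = 0 := by
  have h := (Equiv.subLeft (-(2 * i + 1))).tsum_eq
    fun n : ℤ => (-1) ^ n * e (τ * (n ^ 2 + n * (2 * i + 1)))
  have h2 : ∀ n : ℤ, (-1) ^ (Equiv.subLeft (-(2 * i + 1)) n)
      * e (τ * ((Equiv.subLeft (-(2 * i + 1)) n : ℤ) ^ 2
        + (Equiv.subLeft (-(2 * i + 1)) n : ℤ) * (2 * i + 1)))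
      = -((-1) ^ n * e (τ * (n ^ 2 + n * (2 * i + 1)))) := by
    intro n
    have s : (-1 : ℂ) ^ (-(2 * i + 1) - n) = -(-1) ^ n := by
      rw [show -(2 * i + 1) - n = 2 * (-i - n) + (n - 1) by ring, zpow_add₀ (by norm_num), zpow_mul,
        zpow_sub_one₀ (by norm_num)]
      norm_num
    rw [Equiv.subLeft_apply, s, neg_mul]
    congr 3; push_cast; ring
  rw [tsum_congr h2, tsum_neg] at h
  linear_combination -h / 2

/-- The indicator of `-p ≤ i` does not involve `n`, so it multiplies a vanishing complete sum. What
is left separates `n` from `p`. -/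
lemma tsum_coreTerm_middle {τ : ℂ} (hτ : 0 < τ.im) (m : ℕ) (z u : ℂ) (p i : ℤ) :
    ∑' n : ℤ, coreTerm m τ z u p n i = partialTheta m τ i
      * e (τ * (m * p ^ 2 - p * (2 * i + 1)) + (2 * i + 1 - m * p) * z + m * p * u) := by
  set E := e (τ * (m * p ^ 2 - p * (2 * i + 1)) + (2 * i + 1 - m * p) * z + m * p * u) with hE
  have h : ∀ n : ℤ, coreTerm m τ z u p n i
      = ((-1) ^ n * e (τ * (n ^ 2 + n * (2 * i + 1))) * (if m * n ≤ i then 1 else 0)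
        - (if -p ≤ i then 1 else 0) * ((-1) ^ n * e (τ * (n ^ 2 + n * (2 * i + 1))))) * E := by
    intro n
    have : e (τ * (n ^ 2 + n * (2 * i + 1) + m * p ^ 2 - p * (2 * i + 1))
        + (2 * i + 1 - m * p) * z + m * p * u) = e (τ * (n ^ 2 + n * (2 * i + 1))) * E := by
      rw [hE, ← e_add]; congr 1; ring
    rw [coreTerm, this]; ring
  rw [tsum_congr h, tsum_mul_right, Summable.tsum_sub, tsum_mul_left, tsum_sign_mul_e_eq_zero,
    mul_zero, sub_zero, partialTheta]
  · refine (summable_sign_mul_e hτ i).norm.of_norm_bounded fun n => ?_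
    rw [norm_mul]
    refine mul_le_of_le_one_right (norm_nonneg _) ?_
    split_ifs <;> simp
  · exact (summable_sign_mul_e hτ i).mul_left _

/-- Exchange the order of summation in the triple series. -/
lemma tsum_coreTerm_eq {m : ℕ} (hm : 1 ≤ m) {τ : ℂ} (hτ : 0 < τ.im) (z u : ℂ) :
    Summable (fun i : ℤ => partialTheta m τ i * thetaFactor m τ z u i) ∧
    ∑' x : (ℤ × ℤ) × ℤ, coreTerm m τ z u x.1.1 x.1.2 x.2
      = ∑' i : ℤ, partialTheta m τ i * thetaFactor m τ z u i := by
  let σ : (ℤ × ℤ) × ℤ ≃ (ℤ × ℤ) × ℤ :=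
    ⟨fun x => ((x.1.2, x.2), x.1.1), fun x => ((x.2, x.1.1), x.1.2), fun _ => rfl, fun _ => rfl⟩
  have hs := summable_coreTerm hm hτ z u
  have hs' := σ.summable_iff.mpr hs
  have h1 : ∀ i p : ℤ, ∑' n : ℤ, ((fun x : (ℤ × ℤ) × ℤ => coreTerm m τ z u x.1.1 x.1.2 x.2) ∘ σ)
      ((i, p), n) = partialTheta m τ i
      * e (τ * (m * p ^ 2 - p * (2 * i + 1)) + (2 * i + 1 - m * p) * z + m * p * u) :=
    fun i p => tsum_coreTerm_middle hτ m z u p i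
  have hs2 := hs'.prod
  have h2 : ∀ i : ℤ, ∑' p : ℤ, ∑' n : ℤ,
      ((fun x : (ℤ × ℤ) × ℤ => coreTerm m τ z u x.1.1 x.1.2 x.2) ∘ σ) ((i, p), n)
      = partialTheta m τ i * thetaFactor m τ z u i := fun i => by
    simp only [h1]; rw [tsum_mul_left, thetaFactor]
  constructor
  · exact hs2.prod.congr fun i => h2 i
  · exact (σ.tsum_eq _).symm.trans (hs'.tsum_prod.trans (hs2.tsum_prod.trans (tsum_congr h2)))

lemma exists_norm_inv_one_sub_e_le {τ : ℂ} (hτ : 0 < τ.im) (z : ℂ) :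
    ∃ C, 0 < C ∧ ∀ j : ℤ, ‖(1 - e (z + j * τ))⁻¹‖ ≤ C := by
  obtain ⟨C, h0, hC⟩ := exists_norm_inv_one_sub_mul_zpow_le (e_ne_zero τ) (norm_e_lt_one hτ)
    (e_ne_zero z)
  exact ⟨C, h0, fun j => by rw [e_add, e_int_mul]; exact hC j⟩

lemma summable_norm_div_one_sub_e {τ : ℂ} (hτ : 0 < τ.im) (z : ℂ) {f : ℤ → ℂ}
    (hf : Summable fun j => ‖f j‖) : Summable fun j : ℤ => ‖f j / (1 - e (z + j * τ))‖ := by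
  obtain ⟨C, h0, hC⟩ := exists_norm_inv_one_sub_e_le hτ z
  refine .of_nonneg_of_le (fun _ => norm_nonneg _) (fun n => ?_) (hf.mul_right C)
  rw [div_eq_mul_inv, norm_mul]
  gcongr
  exact hC n

lemma two_mul_im_pos {τ : ℂ} (hτ : 0 < τ.im) : 0 < (2 * τ).im := by simpa using hτ

lemma natCast_mul_im_pos {τ : ℂ} (hτ : 0 < τ.im) {k : ℕ} (hk : 0 < k) : 0 < (τ * k).im := by
  have : (τ * k).im = τ.im * k := by
    have := Complex.im_mul_ofReal τ (k : ℝ)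
    push_cast at this; exact this
  rw [this]; positivity

lemma summable_norm_appell {m : ℕ} (hm : 1 ≤ m) {τ : ℂ} (hτ : 0 < τ.im) (z u : ℂ) :
    Summable fun j : ℤ => ‖e (τ * (m * j ^ 2 + j) + m * j * (z - u) + z)
      / (1 - e (2 * z + 2 * j * τ))‖ := by
  refine (summable_norm_div_one_sub_e (two_mul_im_pos hτ) (2 * z) (summable_norm_e_sq
    (natCast_mul_im_pos hτ hm) (τ + m * (z - u)) z)).congr fun j => ?_
  congr 3
  · congr 1; ring
  · congr 1; ring

lemma summable_norm_polarSeries {τ : ℂ} (hτ : 0 < τ.im) (z : ℂ) :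
    Summable fun n : ℤ => ‖(-1) ^ n * e (τ * (n ^ 2 + n) + z) / (1 - e (2 * z + 2 * n * τ))‖ := by
  refine (summable_norm_div_one_sub_e (two_mul_im_pos hτ) (2 * z) (summable_norm_e_sq
    hτ τ z)).congr fun j => ?_
  rw [mul_div_assoc, norm_neg_one_zpow_mul]
  congr 3
  · congr 1; ring
  · congr 1; ring

lemma summable_norm_altTheta (m : ℕ) {τ : ℂ} (hτ : 0 < τ.im) (x : ℂ) :
    Summable fun n : ℤ => ‖(-1) ^ n * e (τ * ((m + 1) * n ^ 2) + n * x)‖ := by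
  refine (summable_norm_e_sq (natCast_mul_im_pos hτ (Nat.succ_pos m)) x 0).congr fun n => ?_
  rw [norm_neg_one_zpow_mul]
  congr 2; push_cast; ring

/-- The dependence on `i` is `y^i`, so the sum is geometric. The end `y^(mn)` gives a term of
`altTheta * appell` at indices `(n, n-p)`, the end `y^(-p)` a term of `altTheta * polarSeries` at
`(-p, n-p)`. -/
lemma tsum_coreTerm_last {m : ℕ} {τ z : ℂ} (hz : ∀ a b : ℤ, z ≠ (a : ℂ) / 2 + b * τ) (u : ℂ)
    (p n : ℤ) :
    ∑' i : ℤ, coreTerm m τ z u p n i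
      = (-1) ^ n * e (τ * ((m + 1) * n ^ 2) + n * (m * (z + u)))
          * (e (τ * (m * (n - p : ℤ) ^ 2 + (n - p : ℤ)) + m * (n - p : ℤ) * (z - u) + z)
            / (1 - e (2 * z + 2 * (n - p : ℤ) * τ)))
        - (-1) ^ (-p) * e (τ * ((m + 1) * (-p : ℤ) ^ 2)
            + (-p : ℤ) * ((z + u) + (m + 1) * (z - u)))
          * ((-1) ^ (n - p) * e (τ * ((n - p : ℤ) ^ 2 + (n - p : ℤ)) + z)
            / (1 - e (2 * z + 2 * (n - p : ℤ) * τ))) := by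
  set y := e (2 * z + 2 * (n - p : ℤ) * τ) with hy
  have hy0 : y ≠ 0 := e_ne_zero _
  have hy1 : 1 - y ≠ 0 := one_sub_e_ne_zero hz _
  set E := e (τ * (n ^ 2 + n + m * p ^ 2 - p) + (1 - m * p) * z + m * p * u) with hE
  have h : ∀ i : ℤ, coreTerm m τ z u p n i = (-1) ^ n * E
      * (y ^ i * ((if m * n ≤ i then 1 else 0) - (if -p ≤ i then 1 else 0))) := by
    intro i
    have : e (τ * (n ^ 2 + n * (2 * i + 1) + m * p ^ 2 - p * (2 * i + 1))
        + (2 * i + 1 - m * p) * z + m * p * u) = E * y ^ i := by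
      rw [hE, hy, ← e_int_mul, ← e_add]; congr 1; push_cast; ring
    rw [coreTerm, this]; ring
  rw [tsum_congr h, tsum_mul_left, (hasSum_zpow_mul_indicator_sub hy0 hy1 _ _).tsum_eq]
  have s : (-1 : ℂ) ^ (-p) * (-1) ^ (n - p) = (-1) ^ n := by
    rw [← zpow_add₀ (by norm_num), show -p + (n - p) = n + 2 * (-p) by ring,
      zpow_add₀ (by norm_num), zpow_mul]
    norm_num
  have e1 : E * y ^ ((m : ℤ) * n) = e (τ * ((m + 1) * n ^ 2) + n * (m * (z + u)))
      * e (τ * (m * (n - p : ℤ) ^ 2 + (n - p : ℤ)) + m * (n - p : ℤ) * (z - u) + z) := by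
    rw [hE, hy, ← e_int_mul, ← e_add, ← e_add]; congr 1; push_cast; ring
  have e2 : E * y ^ (-p) = e (τ * ((m + 1) * (-p : ℤ) ^ 2)
            + (-p : ℤ) * ((z + u) + (m + 1) * (z - u)))
      * e (τ * ((n - p : ℤ) ^ 2 + (n - p : ℤ)) + z) := by
    rw [hE, hy, ← e_int_mul, ← e_add, ← e_add]; congr 1; push_cast; ring
  linear_combination (-1) ^ n / (1 - y) * (e1 - e2)
    + e (τ * ((m + 1) * (-p : ℤ) ^ 2) + (-p : ℤ) * ((z + u) + (m + 1) * (z - u)))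
      * e (τ * ((n - p : ℤ) ^ 2 + (n - p : ℤ)) + z) / (1 - y) * s

/-- The product formula. -/
lemma altTheta_mul_appell_sub {m : ℕ} (hm : 1 ≤ m) {τ z : ℂ} (hτ : 0 < τ.im)
    (hz : ∀ a b : ℤ, z ≠ (a : ℂ) / 2 + b * τ) (u : ℂ) :
    altTheta m τ (m * (z + u)) * appell m τ z u
        - altTheta m τ (z + u + (m + 1) * (z - u)) * polarSeries τ z
      = ∑' i : ℤ, partialTheta m τ i * thetaFactor m τ z u i := by
  have a1 := summable_norm_altTheta m hτ (m * (z + u))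
  have a2 := summable_norm_appell hm hτ z u
  have a3 := summable_norm_altTheta m hτ (z + u + (m + 1) * (z - u))
  have a4 := summable_norm_polarSeries hτ z
  let σ₁ : ℤ × ℤ ≃ ℤ × ℤ := ⟨fun x => (x.2, x.2 - x.1), fun x => (x.1 - x.2, x.1),
    fun x => by simp, fun x => by simp⟩
  let σ₂ : ℤ × ℤ ≃ ℤ × ℤ := ⟨fun x => (-x.1, x.2 - x.1), fun x => (-x.1, x.2 - x.1),
    fun x => by simp, fun x => by simp⟩
  have s1 := (summable_mul_of_summable_norm a1 a2)
  have s2 := (summable_mul_of_summable_norm a3 a4)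
  rw [altTheta, altTheta, appell, polarSeries, tsum_mul_tsum_of_summable_norm a1 a2,
    tsum_mul_tsum_of_summable_norm a3 a4, ← (tsum_coreTerm_eq hm hτ z u).2,
    (summable_coreTerm hm hτ z u).tsum_prod]
  refine (congrArg₂ (· - ·) (σ₁.tsum_eq _).symm (σ₂.tsum_eq _).symm).trans ?_
  refine ((σ₁.summable_iff.mpr s1).tsum_sub (σ₂.summable_iff.mpr s2)).symm.trans ?_
  exact tsum_congr fun x => (tsum_coreTerm_last hz u x.1 x.2).symm

/-! ### Reduction of `Phi` to Appell series. -/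

lemma Phi2_eq_Phi1 (m τ z₁ z₂ : ℂ) : Phi2 m 0 τ z₁ z₂ 0 = Phi1 m 0 τ (-z₂) (-z₁) 0 := by
  rw [Phi1, Phi2]
  congr 1
  refine tsum_congr fun j => ?_
  congr 3
  ring

/-- The half shifts leave the sum of the two arguments, hence the numerators, unchanged and send `X
= e(a + jτ)` to `-X`; then `1/(1-X) - 1/(1+X) = 2X/(1-X²)`. -/
lemma Phi1_sub_Phi1_add_half {m : ℕ} (hm : 1 ≤ m) {τ a : ℂ} (hτ : 0 < τ.im)
    (ha : ∀ k l : ℤ, a ≠ (k : ℂ) / 2 + l * τ) (b : ℂ) :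
    Phi1 m 0 τ a (-b) 0 - Phi1 m 0 τ (a + 1 / 2) (-b - 1 / 2) 0 = 2 * appell m τ a b := by
  have hs := summable_norm_e_sq (natCast_mul_im_pos hτ hm) (m * (a - b)) 0
  have s1 := (summable_norm_div_one_sub_e hτ a hs).of_norm
  have s2 := (summable_norm_div_one_sub_e hτ (a + 1 / 2) hs).of_norm
  have t1 : Phi1 m 0 τ a (-b) 0 = ∑' j : ℤ, e (τ * m * j ^ 2 + m * (a - b) * j + 0)
      / (1 - e (a + j * τ)) := by
    rw [Phi1, mul_zero, neg_zero, e_zero, one_mul]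
    refine tsum_congr fun j => ?_
    rw [qPow_eq_e, qPow_eq_e, ← e_add, ← e_add]
    congr 2
    · ring
    · congr 1; ring
  have t2 : Phi1 m 0 τ (a + 1 / 2) (-b - 1 / 2) 0
      = ∑' j : ℤ, e (τ * m * j ^ 2 + m * (a - b) * j + 0) / (1 - e (a + 1 / 2 + j * τ)) := by
    rw [Phi1, mul_zero, neg_zero, e_zero, one_mul]
    refine tsum_congr fun j => ?_
    rw [qPow_eq_e, qPow_eq_e, ← e_add, ← e_add]
    congr 2
    · ring
    · congr 1; ring
  rw [t1, t2, ← s1.tsum_sub s2, appell, ← tsum_mul_left]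
  refine tsum_congr fun j => ?_
  have e1 : e (a + 1 / 2 + j * τ) = -e (a + j * τ) := by
    rw [show a + 1 / 2 + j * τ = a + j * τ + 1 / 2 by ring, e_add, e_half]; ring
  have e2 : e (2 * a + 2 * j * τ) = e (a + j * τ) ^ 2 := by
    rw [sq, ← e_add]; congr 1; ring
  have e3 : e (τ * (m * j ^ 2 + j) + m * j * (a - b) + a)
      = e (τ * m * j ^ 2 + m * (a - b) * j + 0) * e (a + j * τ) := by
    rw [← e_add]; congr 1; ring
  have hne := one_sub_e_ne_zero ha j
  rw [e2] at hne
  rw [e1, e2, e3]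
  have hne' : (1 - e (a + j * τ)) * (1 + e (a + j * τ)) ≠ 0 := by
    convert hne using 1; ring
  have h1 := left_ne_zero_of_mul hne'
  have h2 := right_ne_zero_of_mul hne'
  rw [sub_neg_eq_add, show 1 - e (a + j * τ) ^ 2 = (1 - e (a + j * τ)) * (1 + e (a + j * τ)) by ring]
  generalize e (a + j * τ) = X at h1 h2 ⊢
  field_simp
  ring

lemma Phi_sub_Phi {m : ℕ} (hm : 1 ≤ m) {τ z₁ z₃ : ℂ} (hτ : 0 < τ.im)
    (hz₁ : ∀ a b : ℤ, z₁ ≠ (a : ℂ) / 2 + b * τ) (hz₃ : ∀ a b : ℤ, z₃ ≠ (a : ℂ) / 2 + b * τ) :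
    Phi m 0 τ z₁ (-z₃) 0 - Phi m 0 τ (z₁ + 1 / 2) (-z₃ - 1 / 2) 0
      = 2 * (appell m τ z₁ z₃ - appell m τ z₃ z₁) := by
  have h1 := Phi1_sub_Phi1_add_half hm hτ hz₁ z₃
  have h2 := Phi1_sub_Phi1_add_half hm hτ hz₃ z₁
  rw [Phi, Phi, Phi2_eq_Phi1, Phi2_eq_Phi1, neg_neg, show -(-z₃ - 1 / 2) = z₃ + 1 / 2 by ring,
    show -(z₁ + 1 / 2) = -z₁ - 1 / 2 by ring]
  linear_combination h1 - h2

/-! ### Symmetries of the theta and partial theta series. -/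

lemma theta_zero_half (m : ℕ) (τ x : ℂ) :
    theta 0 (m + 1) τ ((1 / 2 + x) / (m + 1)) = altTheta m τ x := by
  refine tsum_congr fun j => ?_
  have : (m : ℂ) + 1 ≠ 0 := by exact_mod_cast Nat.succ_ne_zero m
  rw [qPow_eq_e, ← e_add, ← e_int_div_two, ← e_add]
  congr 1
  field_simp
  ring

lemma altTheta_sub_one (m : ℕ) (τ x : ℂ) : altTheta m τ (x - 1) = altTheta m τ x := by
  refine tsum_congr fun j => ?_
  have := e_add (τ * ((m + 1) * j ^ 2) + j * (x - 1)) j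
  rw [e_int, mul_one] at this
  rw [← this]
  congr 2; ring

lemma theta_add_period {m : ℕ} (hm : 1 ≤ m) (τ x k : ℂ) (r : ℤ) :
    theta (k + 2 * m * r) m τ x = theta k m τ x := by
  have hm0 : (m : ℂ) ≠ 0 := by exact_mod_cast (by omega : m ≠ 0)
  rw [theta, theta, ← (Equiv.addRight r).tsum_eq
    fun j : ℤ => e (m * (j + k / (2 * m)) * x) * qPow τ (m * (j + k / (2 * m)) ^ 2)]
  refine tsum_congr fun j => ?_
  have : (j : ℂ) + (k + 2 * m * r) / (2 * m) = (Equiv.addRight r j : ℤ) + k / (2 * m) := by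
    rw [Equiv.coe_addRight]; push_cast; field_simp; ring
  rw [this]

lemma theta_neg_right (k m τ x : ℂ) : theta k m τ (-x) = theta (-k) m τ x := by
  rw [theta, theta, ← (Equiv.neg ℤ).tsum_eq
    fun j : ℤ => e (m * (j + -k / (2 * m)) * x) * qPow τ (m * (j + -k / (2 * m)) ^ 2)]
  refine tsum_congr fun j => ?_
  have : ((Equiv.neg ℤ j : ℤ) : ℂ) + -k / (2 * m) = -(j + k / (2 * m)) := by
    rw [Equiv.neg_apply]; push_cast; ring
  rw [this]
  congr 2 <;> ring

/-- Complete the square in `m p² - p(2i+1)` and put `p = -j`. -/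
lemma thetaFactor_eq {m : ℕ} (hm : 1 ≤ m) (τ z u : ℂ) (i : ℤ) :
    thetaFactor m τ z u i = e ((2 * i + 1) * (z + u) / 2 - τ * ((2 * i + 1) ^ 2 / (4 * m)))
      * theta (2 * i + 1) m τ (z - u) := by
  have hm0 : (m : ℂ) ≠ 0 := by exact_mod_cast (by omega : m ≠ 0)
  rw [theta, thetaFactor, ← tsum_mul_left, ← (Equiv.neg ℤ).tsum_eq]
  refine tsum_congr fun j => ?_
  rw [qPow_eq_e, ← e_add, ← e_add, Equiv.neg_apply]
  congr 1
  push_cast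
  field_simp
  ring

/-- The antisymmetrized theta function `θ_{c,m} - θ_{-c,m}`. -/
noncomputable def oddTheta (m : ℕ) (τ x : ℂ) (c : ℤ) : ℂ := theta c m τ x - theta (-c) m τ x

lemma oddTheta_neg (m : ℕ) (τ x : ℂ) (c : ℤ) : oddTheta m τ x (-c) = -oddTheta m τ x c := by
  simp [oddTheta]

lemma oddTheta_add_period {m : ℕ} (hm : 1 ≤ m) (τ x : ℂ) (c r : ℤ) :
    oddTheta m τ x (c + 2 * m * r) = oddTheta m τ x c := by
  rw [oddTheta, oddTheta, ← theta_add_period hm τ x c r, ← theta_add_period hm τ x (-c) (-r)]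
  congr 2 <;> push_cast <;> ring

/-- An odd multiple of `m` is congruent to its negative modulo `2m`. Hence the residue `m` drops out
of the final sums. -/
lemma oddTheta_odd_mul {m : ℕ} (hm : 1 ≤ m) (τ x : ℂ) (r : ℤ) :
    oddTheta m τ x ((2 * r + 1) * m) = 0 := by
  rw [oddTheta, ← theta_add_period hm τ x (-((2 * r + 1) * m : ℤ)) (2 * r + 1), sub_eq_zero]
  congr 1; push_cast; ring

lemma exists_norm_oddTheta_le {m : ℕ} (hm : 1 ≤ m) (τ x : ℂ) :
    ∃ B, 0 < B ∧ ∀ c : ℤ, ‖oddTheta m τ x c‖ ≤ B := by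
  obtain ⟨B, hB⟩ := ((Set.finite_Ico (0 : ℤ) (2 * m)).image
    fun c => ‖oddTheta m τ x c‖).bddAbove
  refine ⟨max B 1, by positivity, fun c => le_trans ?_ (le_max_left _ _)⟩
  rw [← Int.emod_add_mul_ediv c (2 * m), oddTheta_add_period hm]
  exact hB ⟨_, ⟨Int.emod_nonneg _ (by omega), Int.emod_lt_of_pos _ (by omega)⟩, rfl⟩

lemma thetaFactor_sub {m : ℕ} (hm : 1 ≤ m) (τ z u : ℂ) (i : ℤ) :
    thetaFactor m τ z u i - thetaFactor m τ u z i
      = e ((2 * i + 1) * (z + u) / 2 - τ * ((2 * i + 1) ^ 2 / (4 * m)))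
        * oddTheta m τ (z - u) (2 * i + 1) := by
  rw [thetaFactor_eq hm, thetaFactor_eq hm, ← neg_sub z u, theta_neg_right, add_comm u z, oddTheta]
  push_cast
  ring

lemma partialTheta_eq_neg {τ : ℂ} (hτ : 0 < τ.im) (m : ℕ) (i : ℤ) :
    partialTheta m τ i
      = -∑' n : ℤ, (-1) ^ n * e (τ * (n ^ 2 + n * (2 * i + 1))) * (if i < m * n then 1 else 0) := by
  rw [eq_neg_iff_add_eq_zero, partialTheta, ← Summable.tsum_add]
  · refine (tsum_congr fun n => ?_).trans (tsum_sign_mul_e_eq_zero τ i)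
    rcases le_or_gt (m * n) i with h | h
    · rw [if_pos h, if_neg h.not_gt]; ring
    · rw [if_neg h.not_ge, if_pos h]; ring
  all_goals
    refine (summable_sign_mul_e hτ i).norm.of_norm_bounded fun n => ?_
    rw [norm_mul]
    refine mul_le_of_le_one_right (norm_nonneg _) ?_
    split_ifs <;> simp

/-- Under `i ↦ -(i+1)` and `n ↦ -n` the exponent is unchanged, while the condition `mn ≤ i` becomes
its complement; the complete sum vanishes. -/
lemma partialTheta_neg {τ : ℂ} (hτ : 0 < τ.im) (m : ℕ) (i : ℤ) :
    partialTheta m τ (-(i + 1)) = -partialTheta m τ i := by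
  rw [partialTheta_eq_neg hτ m i, neg_neg, partialTheta, ← (Equiv.neg ℤ).tsum_eq]
  refine tsum_congr fun n => ?_
  have h1 : ((m : ℤ) * (Equiv.neg ℤ) n ≤ -(i + 1)) ↔ i < m * n := by
    rw [Equiv.neg_apply, mul_neg]; omega
  have h2 : (-1 : ℂ) ^ (Equiv.neg ℤ n) = (-1) ^ n := by
    rw [Equiv.neg_apply, zpow_neg, ← inv_zpow]; norm_num
  simp only [h1, h2]
  congr 3
  rw [Equiv.neg_apply]; push_cast; ring

/-- The part of `partialTheta` over positive indices. -/
lemma partialTheta_natCast {m : ℕ} {τ : ℂ} (hτ : 0 < τ.im) (i : ℕ) :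
    partialTheta m τ i = -∑' j : ℕ+, (-1) ^ (j : ℕ) * e (τ * ((j : ℕ) ^ 2 + (j : ℕ) * (2 * i + 1)))
      * (if i < m * (j : ℕ) then 1 else 0) := by
  rw [partialTheta_eq_neg hτ, ← Function.Injective.tsum_eq (g := fun j : ℕ+ => ((j : ℕ) : ℤ))]
  · congr 1
    refine tsum_congr fun j => ?_
    have : ((i : ℤ) < m * ((j : ℕ) : ℤ)) ↔ i < m * (j : ℕ) := by exact_mod_cast Iff.rfl
    simp only [this, zpow_natCast]
    push_cast
    rfl
  · intro a b h
    simpa using h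
  · intro n hn
    rw [Function.mem_support] at hn
    have h : (i : ℤ) < m * n := by
      by_contra h; simp [h] at hn
    have hn0 : 0 < n := by
      by_contra h0
      have := mul_nonpos_of_nonneg_of_nonpos (Int.natCast_nonneg m) (not_lt.mp h0)
      omega
    exact ⟨⟨n.toNat, by omega⟩, by simp; omega⟩

/-! ### The two triple sums. -/

/-- The common general term of `termA` and `termB`, indexed by an odd integer `c`. -/
noncomputable def oddTerm (m : ℕ) (τ z u : ℂ) (j : ℕ) (c : ℤ) : ℂ :=
  (-1) ^ j * e (τ * (j ^ 2 + j * c - c ^ 2 / (4 * m)))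
    * (e (c * (z + u) / 2) + e (-(c * (z + u) / 2))) * oddTheta m τ (z - u) c

/-- From `c ≤ 2mj` follow `c²/(4m) ≤ jc/2` and `c²/(8m²) ≤ j²/2`. -/
lemma odd_exponent_bound {m j c : ℝ} (hm : 1 ≤ m) (h0 : 0 ≤ c) (h1 : c ≤ 2 * m * j) :
    j ^ 2 / 2 + c ^ 2 / (8 * m ^ 2) ≤ j ^ 2 + j * c - c ^ 2 / (4 * m) := by
  have h2 : c ^ 2 / (8 * m ^ 2) ≤ j ^ 2 / 2 := by
    rw [div_le_iff₀ (by positivity)]; nlinarith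
  have h3 : c ^ 2 / (4 * m) ≤ j * c / 2 := by
    rw [div_le_iff₀ (by positivity)]; nlinarith
  have h4 : 0 ≤ j := by
    by_contra h; nlinarith
  have := mul_nonneg h4 h0
  linarith

lemma norm_oddTerm_le {m : ℕ} (hm : 1 ≤ m) {τ : ℂ} (hτ : 0 < τ.im) (z u : ℂ) {B : ℝ}
    (hB : ∀ c : ℤ, ‖oddTheta m τ (z - u) c‖ ≤ B) {j i : ℕ} (hi : i < m * j) :
    ‖oddTerm m τ z u j (2 * i + 1)‖ ≤ ‖e (τ / 2 * (j : ℤ) ^ 2 + 0 * (j : ℤ) + 0)‖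
      * ((‖e (τ / (2 * m ^ 2) * (i : ℤ) ^ 2 + (τ / (2 * m ^ 2) + (z + u)) * (i : ℤ)
          + (τ / (8 * m ^ 2) + (z + u) / 2))‖
        + ‖e (τ / (2 * m ^ 2) * (i : ℤ) ^ 2 + (τ / (2 * m ^ 2) - (z + u)) * (i : ℤ)
          + (τ / (8 * m ^ 2) - (z + u) / 2))‖) * B) := by
  have hm' : (1 : ℝ) ≤ m := by exact_mod_cast hm
  have hm0 : (m : ℂ) ≠ 0 := by exact_mod_cast (by omega : m ≠ 0)
  have hb := odd_exponent_bound (m := m) (j := j) (c := 2 * i + 1) hm' (by positivity) (by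
    have h1 : 2 * i + 1 ≤ 2 * (m * j) := by omega
    have h2 : ((2 * i + 1 : ℕ) : ℝ) ≤ (2 * (m * j) : ℕ) := by exact_mod_cast h1
    push_cast at h2; linarith)
  have key : ‖e (τ * (j ^ 2 + j * (2 * i + 1) - (2 * i + 1) ^ 2 / (4 * m)))‖
      ≤ ‖e (τ / 2 * (j : ℤ) ^ 2 + 0 * (j : ℤ) + 0)‖ * ‖e (τ * ((2 * i + 1) ^ 2 / (8 * m ^ 2)))‖ := by
    rw [← norm_mul, ← e_add, norm_e, norm_e, Real.exp_le_exp]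
    have e1 : τ * (j ^ 2 + j * (2 * i + 1) - (2 * i + 1) ^ 2 / (4 * m))
        = τ * (((j : ℝ) ^ 2 + j * (2 * i + 1) - (2 * i + 1) ^ 2 / (4 * m) : ℝ) : ℂ) := by
      push_cast; ring
    have e2 : τ / 2 * (j : ℤ) ^ 2 + 0 * (j : ℤ) + 0 + τ * ((2 * i + 1) ^ 2 / (8 * m ^ 2))
        = τ * (((j : ℝ) ^ 2 / 2 + (2 * i + 1) ^ 2 / (8 * m ^ 2) : ℝ) : ℂ) := by
      push_cast; ring
    rw [e1, e2, Complex.im_mul_ofReal, Complex.im_mul_ofReal]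
    have := mul_le_mul_of_nonneg_left hb hτ.le
    have := mul_le_mul_of_nonneg_left this Real.pi_pos.le
    linarith
  have e3 : e (τ / (2 * m ^ 2) * (i : ℤ) ^ 2 + (τ / (2 * m ^ 2) + (z + u)) * (i : ℤ)
      + (τ / (8 * m ^ 2) + (z + u) / 2))
      = e (τ * ((2 * i + 1) ^ 2 / (8 * m ^ 2))) * e ((2 * i + 1) * (z + u) / 2) := by
    rw [← e_add]; congr 1; push_cast; field_simp; ring
  have e4 : e (τ / (2 * m ^ 2) * (i : ℤ) ^ 2 + (τ / (2 * m ^ 2) - (z + u)) * (i : ℤ)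
      + (τ / (8 * m ^ 2) - (z + u) / 2))
      = e (τ * ((2 * i + 1) ^ 2 / (8 * m ^ 2))) * e (-((2 * i + 1) * (z + u) / 2)) := by
    rw [← e_add]; congr 1; push_cast; field_simp; ring
  rw [e3, e4, norm_mul, norm_mul, ← mul_add, oddTerm, norm_mul, norm_mul, norm_mul, norm_pow,
    norm_neg, norm_one, one_pow, one_mul]
  push_cast
  calc _ ≤ (‖e (τ / 2 * (j : ℤ) ^ 2 + 0 * (j : ℤ) + 0)‖
        * ‖e (τ * ((2 * i + 1) ^ 2 / (8 * m ^ 2)))‖)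
        * (‖e ((2 * i + 1) * (z + u) / 2)‖ + ‖e (-((2 * i + 1) * (z + u) / 2))‖) * B := by
        gcongr
        · exact norm_add_le _ _
        · exact hB _
    _ = _ := by push_cast; ring

lemma summable_norm_oddTerm {m : ℕ} (hm : 1 ≤ m) {τ : ℂ} (hτ : 0 < τ.im) (z u : ℂ) :
    Summable fun x : ℕ+ × ℕ => ‖oddTerm m τ z u x.1 (2 * x.2 + 1)
      * (if x.2 < m * (x.1 : ℕ) then 1 else 0)‖ := by
  obtain ⟨B, hB0, hB⟩ := exists_norm_oddTheta_le hm τ (z - u)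
  have h2 : 0 < (τ / 2).im := by exact_mod_cast im_div_natCast_pos hτ (k := 2) (by norm_num)
  have hm2 : 0 < (τ / (2 * m ^ 2)).im := by
    exact_mod_cast im_div_natCast_pos hτ (k := 2 * m ^ 2) (by positivity)
  have hj : Function.Injective fun j : ℕ+ => ((j : ℕ) : ℤ) := fun a b h => by simpa using h
  have hi : Function.Injective fun i : ℕ => (i : ℤ) := Nat.cast_injective
  have s1 := (summable_norm_e_sq h2 0 0).comp_injective hj
  have s2 := (((summable_norm_e_sq hm2 (τ / (2 * m ^ 2) + (z + u))
      (τ / (8 * m ^ 2) + (z + u) / 2)).comp_injective hi).add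
    ((summable_norm_e_sq hm2 (τ / (2 * m ^ 2) - (z + u))
      (τ / (8 * m ^ 2) - (z + u) / 2)).comp_injective hi)).mul_right B
  refine .of_nonneg_of_le (fun _ => norm_nonneg _) (fun x => ?_) (s1.mul_of_nonneg s2
    (fun _ => norm_nonneg _) (fun _ => mul_nonneg (add_nonneg (norm_nonneg _) (norm_nonneg _)) hB0.le))
  by_cases h : x.2 < m * (x.1 : ℕ)
  · rw [if_pos h, mul_one]
    exact norm_oddTerm_le hm hτ z u hB h
  · rw [if_neg h, mul_zero, norm_zero]
    exact mul_nonneg (norm_nonneg _)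
      (mul_nonneg (add_nonneg (norm_nonneg _) (norm_nonneg _)) hB0.le)

/-- Each residue of an odd number modulo `2 m` other than `m` is `±k` with `k < m` odd. -/
lemma sum_range_odd_eq {M : Type*} [AddCommMonoid M] (m : ℕ) (G : ℤ → M) (hG : G m = 0) :
    ∑ i ∈ range m, G (2 * i + 1)
      = ∑ k ∈ (Ico 1 m).filter (fun k => Odd k), G (2 * m - k)
        + ∑ k ∈ (Ico 1 m).filter (fun k => Odd k), G k := by
  have h1 : ∑ k ∈ (Ico 1 m).filter (fun k => Odd k), G k
      = ∑ i ∈ (range m).filter (fun i => 2 * i + 1 < m), G (2 * i + 1) := by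
    refine sum_nbij' (fun k => k / 2) (fun i => 2 * i + 1) ?_ ?_ ?_ ?_ ?_
    · intro k hk; simp [Nat.odd_iff] at *; omega
    · intro i hi; simp [Nat.odd_iff] at *; omega
    · intro k hk; simp [Nat.odd_iff] at *; omega
    · intro i hi; omega
    · intro k hk
      simp [Nat.odd_iff] at hk
      congr 1; omega
  have h2 : ∑ k ∈ (Ico 1 m).filter (fun k => Odd k), G (2 * m - k)
      = ∑ i ∈ (range m).filter (fun i => m < 2 * i + 1), G (2 * i + 1) := by
    refine sum_nbij' (fun k => m - 1 - k / 2) (fun i => 2 * m - (2 * i + 1)) ?_ ?_ ?_ ?_ ?_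
    · intro k hk; simp [Nat.odd_iff] at *; omega
    · intro i hi; simp [Nat.odd_iff] at *; omega
    · intro k hk; simp [Nat.odd_iff] at *; omega
    · intro i hi; simp at *; omega
    · intro k hk
      simp [Nat.odd_iff] at hk
      congr 1; omega
  rw [h1, h2, ← sum_filter_add_sum_filter_not (range m) (fun i => m < 2 * i + 1)]
  congr 1
  -- The only other index has `2i+1 = m`, where `G` vanishes.
  refine (sum_subset (fun i hi => ?_) fun i hi hi' => ?_).symm
  · simp at *; omega
  · simp at hi hi'
    rw [← hG]; congr 1; omega

/-- Cut the odd numbers below `2mj` into `j` blocks of length `2m`. The upper half of a block is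
`2mr - k` with `r` its right end, the lower half `2mr + k` with `r` its left end; hence the two
ranges of `r`. -/
lemma sum_range_mul_odd_eq {M : Type*} [AddCommMonoid M] (m j : ℕ) (g : ℤ → M)
    (hg : ∀ r : ℤ, g ((2 * r + 1) * m) = 0) :
    ∑ i ∈ range (m * j), g (2 * i + 1)
      = ∑ r ∈ Icc 1 j, ∑ k ∈ (Ico 1 m).filter (fun k => Odd k), g (2 * m * r - k)
        + ∑ r ∈ range j, ∑ k ∈ (Ico 1 m).filter (fun k => Odd k), g (2 * m * r + k) := by
  induction j with
  | zero => simp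
  | succ j ih =>
    rw [mul_add, mul_one, sum_range_add, ih, sum_Icc_succ_top (by omega), sum_range_succ]
    have h := sum_range_odd_eq m (fun c => g (2 * m * j + c))
      (by rw [← hg j]; congr 1; ring)
    have e1 : ∀ i ∈ range m, g (2 * ((m * j + i : ℕ) : ℤ) + 1) = g (2 * m * j + (2 * i + 1)) := by
      intro i _; congr 1; push_cast; ring
    have e2 : ∀ k ∈ (Ico 1 m).filter (fun k => Odd k), g (2 * m * (j + 1 : ℕ) - k)
        = g (2 * m * j + (2 * m - k)) := by
      intro k _; congr 1; push_cast; ring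
    rw [sum_congr rfl e1, sum_congr rfl e2, h]
    abel

lemma oddTerm_odd_mul {m : ℕ} (hm : 1 ≤ m) (τ z u : ℂ) (j : ℕ) (r : ℤ) :
    oddTerm m τ z u j ((2 * r + 1) * m) = 0 := by
  rw [oddTerm, oddTheta_odd_mul hm, mul_zero]

/-- For `c = 2mr - k` the exponent is `(m+1)j² - (2mj-c)²/(4m) = j² + jc - c²/(4m)`. The minus sign
comes from `c ≡ -k` modulo `2m` and the oddness of `oddTheta`. -/
lemma termA_eq {m : ℕ} (hm : 1 ≤ m) (τ z u : ℂ) (j : ℕ) :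
    termA m τ z u j = -∑ r ∈ Icc 1 j, ∑ k ∈ (Ico 1 m).filter (fun k => Odd k),
      oddTerm m τ z u j (2 * m * r - k) := by
  have hm0 : (m : ℂ) ≠ 0 := by exact_mod_cast (by omega : m ≠ 0)
  rw [termA, ← sum_neg_distrib]
  refine sum_congr rfl fun r _ => ?_
  rw [← sum_neg_distrib]
  refine sum_congr rfl fun k _ => ?_
  have h := oddTheta_add_period hm τ (z - u) (-k) r
  rw [show (-(k : ℤ)) + 2 * m * r = 2 * m * r - k by ring, oddTheta_neg] at h
  rw [oddTerm, h, oddTheta, qPow_eq_e]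
  have e1 : τ * ((m + 1) * (j : ℂ) ^ 2 - (2 * m * ((j : ℂ) - r) + k) ^ 2 / (4 * m))
      = τ * (j ^ 2 + j * ((2 * m * r - k : ℤ) : ℂ) - ((2 * m * r - k : ℤ) : ℂ) ^ 2 / (4 * m)) := by
    push_cast; field_simp; ring
  rw [e1]
  push_cast
  ring

lemma termB_eq {m : ℕ} (hm : 1 ≤ m) (τ z u : ℂ) (j : ℕ) :
    termB m τ z u j = ∑ r ∈ range j, ∑ k ∈ (Ico 1 m).filter (fun k => Odd k),
      oddTerm m τ z u j (2 * m * r + k) := by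
  have hm0 : (m : ℂ) ≠ 0 := by exact_mod_cast (by omega : m ≠ 0)
  rw [termB]
  refine sum_congr rfl fun r _ => ?_
  refine sum_congr rfl fun k _ => ?_
  have h := oddTheta_add_period hm τ (z - u) k r
  rw [add_comm] at h
  rw [oddTerm, h, oddTheta, qPow_eq_e]
  have e1 : τ * ((m + 1) * (j : ℂ) ^ 2 - (2 * m * ((j : ℂ) - r) - k) ^ 2 / (4 * m))
      = τ * (j ^ 2 + j * ((2 * m * r + k : ℤ) : ℂ) - ((2 * m * r + k : ℤ) : ℂ) ^ 2 / (4 * m)) := by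
    push_cast; field_simp; ring
  rw [e1]
  push_cast
  ring

lemma tsum_mul_ite_lt {E : Type*} [NormedRing E] (f : ℕ → E) (N : ℕ) :
    ∑' i : ℕ, f i * (if i < N then 1 else 0) = ∑ i ∈ range N, f i := by
  rw [tsum_eq_sum (s := range N) fun i hi => by simp at hi; simp [hi]]
  exact sum_congr rfl fun i hi => by simp at hi; simp [hi]

lemma termA_sub_termB {m : ℕ} (hm : 1 ≤ m) (τ z u : ℂ) (j : ℕ) :
    termA m τ z u j - termB m τ z u j = -∑ i ∈ range (m * j), oddTerm m τ z u j (2 * i + 1) := by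
  rw [termA_eq hm, termB_eq hm, sum_range_mul_odd_eq m j _ (oddTerm_odd_mul hm τ z u j)]
  ring

lemma summable_sum_norm_oddTerm {m : ℕ} (hm : 1 ≤ m) {τ : ℂ} (hτ : 0 < τ.im) (z u : ℂ) :
    Summable fun j : ℕ+ => ∑ i ∈ range (m * (j : ℕ)), ‖oddTerm m τ z u j (2 * i + 1)‖ := by
  refine (summable_norm_oddTerm hm hτ z u).prod.congr fun j => ?_
  rw [← tsum_mul_ite_lt]
  refine tsum_congr fun i => ?_
  split_ifs <;> simp

lemma norm_termA_le {m : ℕ} (hm : 1 ≤ m) (τ z u : ℂ) (j : ℕ) :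
    ‖termA m τ z u j‖ ≤ ∑ i ∈ range (m * j), ‖oddTerm m τ z u j (2 * i + 1)‖ := by
  rw [termA_eq hm, norm_neg, sum_range_mul_odd_eq m j (fun c => ‖oddTerm m τ z u j c‖)
    (fun r => by simp only [oddTerm_odd_mul hm, norm_zero])]
  refine le_add_of_le_of_nonneg ?_ (by positivity)
  exact norm_sum_le_of_le _ fun r _ => norm_sum_le _ _

lemma norm_termB_le {m : ℕ} (hm : 1 ≤ m) (τ z u : ℂ) (j : ℕ) :
    ‖termB m τ z u j‖ ≤ ∑ i ∈ range (m * j), ‖oddTerm m τ z u j (2 * i + 1)‖ := by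
  rw [termB_eq hm, sum_range_mul_odd_eq m j (fun c => ‖oddTerm m τ z u j c‖)
    (fun r => by simp only [oddTerm_odd_mul hm, norm_zero])]
  refine le_add_of_nonneg_of_le (by positivity) ?_
  exact norm_sum_le_of_le _ fun r _ => norm_sum_le _ _

lemma summable_termA {m : ℕ} (hm : 1 ≤ m) {τ : ℂ} (hτ : 0 < τ.im) (z u : ℂ) :
    Summable fun j : ℕ+ => termA m τ z u j :=
  .of_norm_bounded (summable_sum_norm_oddTerm hm hτ z u) fun j => norm_termA_le hm τ z u j

lemma summable_termB {m : ℕ} (hm : 1 ≤ m) {τ : ℂ} (hτ : 0 < τ.im) (z u : ℂ) :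
    Summable fun j : ℕ+ => termB m τ z u j :=
  .of_norm_bounded (summable_sum_norm_oddTerm hm hτ z u) fun j => norm_termB_le hm τ z u j

/-- Under `i ↦ -(i+1)` both `partialTheta` and `oddTheta` change sign, so their product survives and
the two exponentials `e(±c(z+u)/2)` add up. -/
lemma partialTheta_mul_thetaFactor_pair {m : ℕ} (hm : 1 ≤ m) {τ : ℂ} (hτ : 0 < τ.im) (z u : ℂ)
    (i : ℕ) :
    partialTheta m τ i * (thetaFactor m τ z u i - thetaFactor m τ u z i)
      + partialTheta m τ (-((i : ℤ) + 1))
        * (thetaFactor m τ z u (-((i : ℤ) + 1)) - thetaFactor m τ u z (-((i : ℤ) + 1)))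
      = -∑' j : ℕ+, oddTerm m τ z u j (2 * i + 1) * (if i < m * (j : ℕ) then 1 else 0) := by
  rw [thetaFactor_sub hm, thetaFactor_sub hm, partialTheta_neg hτ, partialTheta_natCast hτ,
    show 2 * (-((i : ℤ) + 1)) + 1 = -(2 * i + 1) by ring, oddTheta_neg]
  set X := ∑' j : ℕ+, (-1 : ℂ) ^ (j : ℕ) * e (τ * ((j : ℕ) ^ 2 + (j : ℕ) * (2 * i + 1)))
    * (if i < m * (j : ℕ) then 1 else 0) with hX
  have e1 : e ((2 * (i : ℤ) + 1) * (z + u) / 2 - τ * ((2 * (i : ℤ) + 1) ^ 2 / (4 * m)))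
      = e (-(τ * ((2 * i + 1) ^ 2 / (4 * m)))) * e ((2 * i + 1) * (z + u) / 2) := by
    rw [← e_add]; congr 1; push_cast; ring
  have e2 : e ((2 * ((-((i : ℤ) + 1) : ℤ) : ℂ) + 1) * (z + u) / 2
      - τ * ((2 * ((-((i : ℤ) + 1) : ℤ) : ℂ) + 1) ^ 2 / (4 * m)))
      = e (-(τ * ((2 * i + 1) ^ 2 / (4 * m)))) * e (-((2 * i + 1) * (z + u) / 2)) := by
    rw [← e_add]; congr 1; push_cast; ring
  have e3 : ∀ j : ℕ+, oddTerm m τ z u j (2 * i + 1) * (if i < m * (j : ℕ) then 1 else 0)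
      = ((-1 : ℂ) ^ (j : ℕ) * e (τ * ((j : ℕ) ^ 2 + (j : ℕ) * (2 * i + 1)))
        * (if i < m * (j : ℕ) then 1 else 0)) * (e (-(τ * ((2 * i + 1) ^ 2 / (4 * m))))
        * (e ((2 * i + 1) * (z + u) / 2) + e (-((2 * i + 1) * (z + u) / 2)))
        * oddTheta m τ (z - u) (2 * i + 1)) := by
    intro j
    have : e (τ * ((j : ℕ) ^ 2 + (j : ℕ) * ((2 * i + 1 : ℤ) : ℂ)
        - ((2 * i + 1 : ℤ) : ℂ) ^ 2 / (4 * m)))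
        = e (τ * ((j : ℕ) ^ 2 + (j : ℕ) * (2 * i + 1)))
          * e (-(τ * ((2 * i + 1) ^ 2 / (4 * m)))) := by
      rw [← e_add]; congr 1; push_cast; ring
    rw [oddTerm, this]
    push_cast
    ring
  rw [tsum_congr e3, tsum_mul_right, ← hX, e1, e2]
  ring

/-- Fold `ℤ` onto `ℕ` by these pairs and exchange `i` with `j`; for fixed `j` only the finitely many
`i < mj` remain. -/
lemma tsum_partialTheta_mul_sub {m : ℕ} (hm : 1 ≤ m) {τ : ℂ} (hτ : 0 < τ.im) (z u : ℂ) :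
    ∑' i : ℤ, partialTheta m τ i * thetaFactor m τ z u i
        - ∑' i : ℤ, partialTheta m τ i * thetaFactor m τ u z i
      = ∑' j : ℕ+, termA m τ z u j - ∑' j : ℕ+, termB m τ z u j := by
  have s1 := (tsum_coreTerm_eq hm hτ z u).1
  have s2 := (tsum_coreTerm_eq hm hτ u z).1
  have s := s1.sub s2
  have hodd := (summable_norm_oddTerm hm hτ z u).of_norm
  rw [← s1.tsum_sub s2, ← (summable_termA hm hτ z u).tsum_sub (summable_termB hm hτ z u)]
  simp only [← mul_sub] at s ⊢
  refine s.hasSum.nat_add_neg_add_one.tsum_eq.symm.trans ?_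
  refine (tsum_congr (partialTheta_mul_thetaFactor_pair hm hτ z u)).trans ?_
  rw [tsum_neg, Summable.tsum_comm (f := fun (j : ℕ+) (i : ℕ) => oddTerm m τ z u j (2 * i + 1)
    * (if i < m * (j : ℕ) then 1 else 0)) hodd, ← tsum_neg]
  refine tsum_congr fun j => ?_
  rw [termA_sub_termB hm, tsum_mul_ite_lt]

end MockTheta


theorem mainTheorem4 (m : ℕ) (hm : 1 ≤ m) (τ z₁ z₃ : ℂ) (hτ : 0 < τ.im)
    (hz₁ : ∀ a b : ℤ, z₁ ≠ (a : ℂ) / 2 + b * τ)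
    (hz₃ : ∀ a b : ℤ, z₃ ≠ (a : ℂ) / 2 + b * τ) :
    Summable (fun j : ℕ+ => MockTheta.termA m τ z₁ z₃ j) ∧
    Summable (fun j : ℕ+ => MockTheta.termB m τ z₁ z₃ j) ∧
    MockTheta.theta 0 (m + 1) τ ((-1 / 2 + m * (z₁ + z₃)) / (m + 1)) *
        (MockTheta.Phi m 0 τ z₁ (-z₃) 0
          - MockTheta.Phi m 0 τ (z₁ + 1 / 2) (-z₃ - 1 / 2) 0)
      = 2 * Complex.I * ModularForm.eta τ ^ 2 * ModularForm.eta (2 * τ) ^ 2 *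
          (-(MockTheta.theta 0 (m + 1) τ ((1 / 2 + z₁ + z₃) / (m + 1) + z₁ - z₃)
              / (MockTheta.thetaMumford 1 1 τ z₁ * MockTheta.thetaMumford 1 0 τ z₁))
            + MockTheta.theta 0 (m + 1) τ ((1 / 2 + z₁ + z₃) / (m + 1) - z₁ + z₃)
              / (MockTheta.thetaMumford 1 1 τ z₃ * MockTheta.thetaMumford 1 0 τ z₃))
        + 2 * ∑' j : ℕ+, MockTheta.termA m τ z₁ z₃ j
        - 2 * ∑' j : ℕ+, MockTheta.termB m τ z₁ z₃ j := by
  open MockTheta in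
  refine ⟨summable_termA hm hτ z₁ z₃, summable_termB hm hτ z₁ z₃, ?_⟩
  have hm0 : (m : ℂ) + 1 ≠ 0 := by exact_mod_cast Nat.succ_ne_zero m
  have t1 : theta 0 (m + 1) τ ((-1 / 2 + m * (z₁ + z₃)) / (m + 1))
      = altTheta m τ (m * (z₁ + z₃)) := by
    -- `-1/2 = 1/2 - 1`, and `altTheta` has period `1`.
    rw [← altTheta_sub_one, ← theta_zero_half]; congr 2; ring
  have t2 : theta 0 (m + 1) τ ((1 / 2 + z₁ + z₃) / (m + 1) + z₁ - z₃)
      = altTheta m τ (z₁ + z₃ + (m + 1) * (z₁ - z₃)) := by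
    rw [← theta_zero_half]; congr 1; field_simp; ring
  have t3 : theta 0 (m + 1) τ ((1 / 2 + z₁ + z₃) / (m + 1) - z₁ + z₃)
      = altTheta m τ (z₃ + z₁ + (m + 1) * (z₃ - z₁)) := by
    rw [← theta_zero_half]; congr 1; field_simp; ring
  have p1 := eta_div_thetaMumford hτ hz₁
  have p3 := eta_div_thetaMumford hτ hz₃
  have c1 := altTheta_mul_appell_sub hm hτ hz₁ z₃
  have c3 := altTheta_mul_appell_sub hm hτ hz₃ z₁
  have d := tsum_partialTheta_mul_sub hm hτ z₁ z₃
  rw [← c1, ← c3, add_comm z₃ z₁] at d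
  rw [Phi_sub_Phi hm hτ hz₁ hz₃, t1, t2, t3, add_comm z₃ z₁]
  -- Twice the difference of the product formulas for `(z₁, z₃)` and `(z₃, z₁)`, with each
  -- `polarSeries` replaced by its eta-theta quotient.
  linear_combination 2 * d + 2 * altTheta m τ (z₁ + z₃ + (m + 1) * (z₁ - z₃)) * p1
    - 2 * altTheta m τ (z₁ + z₃ + (m + 1) * (z₃ - z₁)) * p3
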